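/- Let $k$ be a field, $k^{s}$ a separable closure of $k$ and $G_k=\mathrm{Gal}(k^{s}/k)$. Let $B(G_k)$ be the Burnside ring of finite continuous $G_k$-sets, let $K_0(\mathrm{Var}_k)$ be the Grothendieck ring of varieties (schemes of finite type) over $k$, let $\mathbb{L}$ be the class of the affine line, and let $\mathrm{art}_k\colon B(G_k)\to K_0(\mathrm{Var}_k)$ be the homomorphism sending the class of a $G_k$-set $S$ to the class of $\operatorname{Spec}\operatorname{Hom}_{G_k}(S,k^{s})$, where $\operatorname{Hom}_{G_k}(S,k^{s})$ is the $k$-algebra of equivariant maps. Let $L$ be a commutative separable (i.e. finite étale) $k$-algebra of dimension $n$, corresponding to the finite $G_k$-set $S$, that is, $S\cong\operatorname{Hom}_{k\text{-alg}}(L,k^{s})$ with $\sigma\in G_k$ acting by $f\mapsto\sigma\circ f$. Let $L^*$ be the torus of invertible elements of $L$, i.e. the affine $k$-group scheme with $L^*(R)=(L\otimes_k R)^{\times}$ for every commutative $k$-algebra $R$. For positive integers $i_1,\dots,i_t$ let $\mathcal{P}_{i_t\dots i_1}(S)$ be the $G_k$-set of $t$-tuples $(S_t,\dots,S_1)$ of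 pairwise disjoint subsets of $S$ with $|S_j|=i_j$. For $1\le i\le n$ define $$\rho_i(S)=\sum_{t=1}^{i}\ \sum_{\substack{(i_1,\dots,i_t):\ i_s\ge 1\\ i_1+\dots+i_t=i}}(-1)^t\,[\mathcal{P}_{i_t\dots i_1}(S)]\in B(G_k).$$ Then $$[L^*]=\mathbb{L}^n+\sum_{i=1}^{n}\mathrm{art}_k(\rho_i(S))\,\mathbb{L}^{n-i}\in K_0(\mathrm{Var}_k).$$ -/

import Mathlib

universe u

open CategoryTheory AlgebraicGeometry MonoidalCategory

namespace GrothendieckVar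

/-- An object of `Over (Spec k)` is a `k`-variety if it is of finite type over `k`. -/
def IsVariety (k : Type u) [Field k] : ObjectProperty (Over (Spec (CommRingCat.of k))) :=
  fun X => LocallyOfFiniteType X.hom ∧ QuasiCompact X.hom

instance (k : Type u) [Field k] : (IsVariety k).IsMonoidal where
  prop_unit := by
    constructor
    · change LocallyOfFiniteType (𝟙 _)
      infer_instance
    · change QuasiCompact (𝟙 _)
      infer_instance
  prop_tensor X Y hX hY := by
    obtain ⟨hX1, hX2⟩ := hX
    obtain ⟨hY1, hY2⟩ := hY
    constructor
    · change LocallyOfFiniteType (Limits.pullback.fst X.hom Y.hom ≫ X.hom)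
      infer_instance
    · change QuasiCompact (Limits.pullback.fst X.hom Y.hom ≫ X.hom)
      infer_instance

/-- The category of varieties over `k`: schemes of finite type over `k`, with `k`-morphisms.
Its monoidal structure is the fibre product over `k`. -/
abbrev Var (k : Type u) [Field k] := (IsVariety k).FullSubcategory

/-- Isomorphism classes of varieties over `k`, a commutative monoid under fibre product. -/
abbrev VarClass (k : Type u) [Field k] := Skeleton (Var k)

/-- The variety `Spec A` of a finitely generated `k`-algebra `A`. -/
noncomputable def specVar (k : Type u) [Field k] (A : Type u) [CommRing A] [Algebra k A]
    [h : Algebra.FiniteType k A] : Var k :=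
  ⟨Over.mk (Spec.map (CommRingCat.ofHom (algebraMap k A))), by
    constructor
    · change LocallyOfFiniteType (Spec.map (CommRingCat.ofHom (algebraMap k A)))
      rw [HasRingHomProperty.Spec_iff (P := @LocallyOfFiniteType)]
      exact RingHom.finiteType_algebraMap.mpr h
    · change QuasiCompact (Spec.map (CommRingCat.ofHom (algebraMap k A)))
      infer_instance⟩

/-- `IsScissor X U Z`: there are a closed immersion `Z ⟶ X` and an open immersion `U ⟶ X` of
`k`-schemes whose images are complementary, i.e. `Z` is (isomorphic to) a closed subscheme of
`X` and `U` is its open complement. -/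
def IsScissor {k : Type u} [Field k] (X U Z : Var k) : Prop :=
  ∃ (i : Z ⟶ X) (j : U ⟶ X), IsClosedImmersion i.hom.left ∧ IsOpenImmersion j.hom.left ∧
    Set.range j.hom.left = (Set.range i.hom.left)ᶜ

theorem IsScissor.tensor {k : Type u} [Field k] {X U Z : Var k} (h : IsScissor X U Z)
    (W : Var k) : IsScissor (W ⊗ X) (W ⊗ U) (W ⊗ Z) := by
  obtain ⟨i, j, hi, hj, h⟩ := h
  have : MorphismProperty.IsStableUnderComposition @IsClosedImmersion :=
    ⟨fun f g _ _ => inferInstance⟩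
  have : MorphismProperty.IsStableUnderComposition @IsOpenImmersion :=
    ⟨fun f g _ _ => inferInstance⟩
  refine ⟨W ◁ i, W ◁ j, ?_, ?_, ?_⟩
  · exact MorphismProperty.pullbackMap (P := @IsClosedImmersion)
      (f := W.obj.hom) (g := Z.obj.hom) (f' := W.obj.hom) (g' := X.obj.hom)
      (i₁ := 𝟙 _) (i₂ := i.hom.left) inferInstance hi (by simp) (by simp)
  · exact MorphismProperty.pullbackMap (P := @IsOpenImmersion)
      (f := W.obj.hom) (g := U.obj.hom) (f' := W.obj.hom) (g' := X.obj.hom)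
      (i₁ := 𝟙 _) (i₂ := j.hom.left) inferInstance hj (by simp) (by simp)
  · have key : ∀ {Y : Var k} (f : Y ⟶ X), Set.range (W ◁ f).hom.left =
        Limits.pullback.snd W.obj.hom X.obj.hom ⁻¹' Set.range f.hom.left := by
      intro Y f
      have := Scheme.Pullback.range_map W.obj.hom Y.obj.hom W.obj.hom X.obj.hom
        (𝟙 _) f.hom.left (𝟙 _) (by simp) (by simp)
      refine Eq.trans ?_ (this.trans ?_)
      · rfl
      · simp
    rw [key, key, h, Set.preimage_compl]


/-- The subgroup of the free abelian group on isomorphism classes of varieties generated by the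
scissor relations `[X] = [U] + [Z]`. It is an ideal for the multiplication induced by the fibre
product. -/
noncomputable def scissorIdeal (k : Type u) [Field k] : Ideal (FreeAbelianGroup (VarClass k)) where
  __ := AddSubgroup.closure {r | ∃ X U Z : Var k, IsScissor X U Z ∧
    r = .of (toSkeleton X) - (.of (toSkeleton U) + .of (toSkeleton Z))}
  smul_mem' c x hx := by
    change x ∈ AddSubgroup.closure _ at hx
    change c * x ∈ AddSubgroup.closure _
    induction c using FreeAbelianGroup.induction_on with
    | zero => rw [zero_mul]; exact zero_mem _
    | neg c ih => rw [neg_mul]; exact neg_mem ih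
    | add a b iha ihb => rw [add_mul]; exact add_mem iha ihb
    | of W =>
      induction W using Quotient.inductionOn with | _ W
      induction hx using AddSubgroup.closure_induction with
      | zero => rw [mul_zero]; exact zero_mem _
      | neg x _ ih => rw [mul_neg]; exact neg_mem ih
      | add x y _ _ ihx ihy => rw [mul_add]; exact add_mem ihx ihy
      | mem r hr =>
        obtain ⟨X, U, Z, h, rfl⟩ := hr
        refine AddSubgroup.subset_closure ⟨W ⊗ X, W ⊗ U, W ⊗ Z, h.tensor W, ?_⟩
        change FreeAbelianGroup.of (toSkeleton W) * _ = _
        simp only [Skeleton.toSkeleton_tensorObj, FreeAbelianGroup.of_mul, mul_sub, mul_add]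

/-- The Grothendieck ring of varieties over `k`. -/
abbrev K0Var (k : Type u) [Field k] : Type (u + 1) :=
  FreeAbelianGroup (VarClass k) ⧸ scissorIdeal k

/-- The class of a variety in the Grothendieck ring of varieties. -/
noncomputable def cls {k : Type u} [Field k] (X : Var k) : K0Var k :=
  Ideal.Quotient.mk (scissorIdeal k) (.of (toSkeleton X))

theorem cls_eq_of_iso {k : Type u} [Field k] {X Y : Var k} (e : X ≅ Y) : cls X = cls Y := by
  unfold cls
  rw [show toSkeleton X = toSkeleton Y from Quotient.sound ⟨e⟩]

theorem IsScissor.cls_eq {k : Type u} [Field k] {X U Z : Var k} (h : IsScissor X U Z) :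
    cls X = cls U + cls Z := by
  rw [cls, cls, cls, ← map_add, Ideal.Quotient.eq]
  exact AddSubgroup.subset_closure ⟨X, U, Z, h, rfl⟩

/-- The Lefschetz class, i.e. the class of the affine line `Spec k[X]`. -/
noncomputable def lefschetz (k : Type u) [Field k] : K0Var k :=
  cls (specVar k (Polynomial k))

/-- A finite set with a continuous (left) action of the topological group `G`. -/
structure FinGSet (G : Type u) [Group G] [TopologicalSpace G] where
  /-- the underlying set -/
  carrier : Type u
  [finite : Finite carrier]
  [action : MulAction G carrier]
  /-- the action is continuous for the discrete topology on the underlying set -/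
  continuous_action : @ContinuousSMul G carrier _ _ ⊥

namespace FinGSet

attribute [instance] FinGSet.finite FinGSet.action

instance (G : Type u) [Group G] [TopologicalSpace G] : CoeSort (FinGSet G) (Type u) :=
  ⟨FinGSet.carrier⟩

variable {G : Type u} [Group G] [TopologicalSpace G] [IsTopologicalGroup G]

theorem isOpen_stabilizer (S : FinGSet G) (s : S) :
    IsOpen (MulAction.stabilizer G s : Set G) := by
  let _ : TopologicalSpace S := ⊥
  have : DiscreteTopology S := ⟨rfl⟩
  exact continuousSMul_iff_stabilizer_isOpen.mp S.continuous_action s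

/-- An action on a finite set is continuous if all stabilizers are open. -/
def ofStabilizer (S : Type u) [Finite S] [MulAction G S]
    (h : ∀ s : S, IsOpen (MulAction.stabilizer G s : Set G)) : FinGSet G where
  carrier := S
  continuous_action := by
    let _ : TopologicalSpace S := ⊥
    have : DiscreteTopology S := ⟨rfl⟩
    exact continuousSMul_iff_stabilizer_isOpen.mpr h

/-- Isomorphism of finite `G`-sets: an equivariant bijection. -/
def Iso (S T : FinGSet G) : Prop :=
  ∃ e : S ≃ T, ∀ (g : G) (s : S), e (g • s) = g • e s

/-- Disjoint union of finite `G`-sets. -/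
def sum (S T : FinGSet G) : FinGSet G :=
  ofStabilizer (S ⊕ T) fun x => by
    rcases x with s | t
    · convert S.isOpen_stabilizer s using 1
      ext g
      simp [MulAction.mem_stabilizer_iff]
    · convert T.isOpen_stabilizer t using 1
      ext g
      simp [MulAction.mem_stabilizer_iff]

/-- Product of finite `G`-sets, with the diagonal action. -/
def prod (S T : FinGSet G) : FinGSet G :=
  ofStabilizer (S × T) fun x => by
    convert (S.isOpen_stabilizer x.1).inter (T.isOpen_stabilizer x.2) using 1
    ext g
    simp [MulAction.mem_stabilizer_iff, Prod.ext_iff]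

/-- The one-point `G`-set. -/
def point (G : Type u) [Group G] [TopologicalSpace G] [IsTopologicalGroup G] : FinGSet G :=
  letI : MulAction G PUnit.{u + 1} :=
    { smul := fun _ x => x, one_smul := fun _ => rfl, mul_smul := fun _ _ _ => rfl }
  ofStabilizer PUnit.{u + 1} fun x => by
    convert isOpen_univ using 1
    ext g
    simp [MulAction.mem_stabilizer_iff]

instance setoid (G : Type u) [Group G] [TopologicalSpace G] : Setoid (FinGSet G) where
  r := Iso
  iseqv :=
    { refl := fun S => ⟨Equiv.refl S, fun _ _ => rfl⟩
      symm := fun ⟨e, he⟩ => ⟨e.symm, fun g t => by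
        rw [Equiv.symm_apply_eq, he, Equiv.apply_symm_apply]⟩
      trans := fun ⟨e, he⟩ ⟨f, hf⟩ => ⟨e.trans f, fun g s => by
        simp only [Equiv.trans_apply, he, hf]⟩ }

/-- The `G`-set `P_{a_t, …, a_1}(S)` of tuples of pairwise disjoint subsets of `S`, the `j`-th of
which has `a j` elements, with `G` acting by taking images of subsets. -/
def tuples (S : FinGSet G) {t : ℕ} (a : Fin t → ℕ) : FinGSet G :=
  letI act : MulAction G {F : Fin t → Set S //
      (∀ j, (F j).ncard = a j) ∧ ∀ i j, i ≠ j → Disjoint (F i) (F j)} :=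
    { smul := fun g F => ⟨fun j => (fun s => g • s) '' F.1 j,
        fun j => by
          rw [Set.ncard_image_of_injective _ (MulAction.injective g), F.2.1 j],
        fun i j hij =>
          (Set.disjoint_image_iff (MulAction.injective g)).mpr (F.2.2 i j hij)⟩
      one_smul := fun F => Subtype.ext <| funext fun j => by
        change (fun s => (1 : G) • s) '' F.1 j = F.1 j
        simp
      mul_smul := fun g h F => Subtype.ext <| funext fun j => by
        change (fun s => (g * h) • s) '' F.1 j =
          (fun s => g • s) '' ((fun s => h • s) '' F.1 j)
        simp only [Set.image_image, mul_smul] }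
  ofStabilizer {F : Fin t → Set S //
      (∀ j, (F j).ncard = a j) ∧ ∀ i j, i ≠ j → Disjoint (F i) (F j)} fun F => by
    have h : (⨅ s : S, MulAction.stabilizer G s) ≤ MulAction.stabilizer G F := by
      intro g hg
      have hg' : ∀ s : S, g • s = s := fun s => (Subgroup.mem_iInf.mp hg) s
      refine Subtype.ext <| funext fun j => ?_
      change (fun s => g • s) '' F.1 j = F.1 j
      simp [hg']
    refine Subgroup.isOpen_mono h ?_
    rw [Subgroup.coe_iInf]
    exact isOpen_iInter_of_finite fun s => S.isOpen_stabilizer s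

end FinGSet

/-- Isomorphism classes of finite continuous `G`-sets. -/
def GSetClass (G : Type u) [Group G] [TopologicalSpace G] : Type (u + 1) :=
  Quotient (FinGSet.setoid G)

/-- The isomorphism class of a finite continuous `G`-set. -/
def GSetClass.mk {G : Type u} [Group G] [TopologicalSpace G] (S : FinGSet G) : GSetClass G :=
  Quotient.mk (FinGSet.setoid G) S

section Burnside

variable (G : Type u) [Group G] [TopologicalSpace G] [IsTopologicalGroup G]

/-- Multiplication of isomorphism classes of `G`-sets is the product of `G`-sets. -/
instance : CommMonoid (GSetClass G) where
  mul := Quotient.map₂ FinGSet.prod (by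
    rintro S S' ⟨e, he⟩ T T' ⟨f, hf⟩
    exact ⟨Equiv.prodCongr e f, fun g x => Prod.ext (he g x.1) (hf g x.2)⟩)
  one := GSetClass.mk (FinGSet.point G)
  mul_assoc := by
    rintro ⟨S⟩ ⟨T⟩ ⟨U⟩
    exact Quotient.sound ⟨Equiv.prodAssoc S T U, fun _ _ => rfl⟩
  mul_comm := by
    rintro ⟨S⟩ ⟨T⟩
    exact Quotient.sound ⟨Equiv.prodComm S T, fun _ _ => rfl⟩
  one_mul := by
    rintro ⟨S⟩
    exact Quotient.sound ⟨Equiv.punitProd S, fun _ _ => rfl⟩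
  mul_one := by
    rintro ⟨S⟩
    exact Quotient.sound ⟨Equiv.prodPUnit S, fun _ _ => rfl⟩

/-- The subgroup of the free abelian group on isomorphism classes of finite continuous `G`-sets
generated by the relations `[S ⊔ T] = [S] + [T]`. It is an ideal for the multiplication induced by
the product of `G`-sets. -/
def burnsideIdeal : Ideal (FreeAbelianGroup (GSetClass G)) where
  __ := AddSubgroup.closure {r | ∃ S T : FinGSet G,
    r = .of (GSetClass.mk (S.sum T)) - (.of (GSetClass.mk S) + .of (GSetClass.mk T))}
  smul_mem' c x hx := by
    change x ∈ AddSubgroup.closure _ at hx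
    change c * x ∈ AddSubgroup.closure _
    induction c using FreeAbelianGroup.induction_on with
    | zero => rw [zero_mul]; exact zero_mem _
    | neg c ih => rw [neg_mul]; exact neg_mem ih
    | add a b iha ihb => rw [add_mul]; exact add_mem iha ihb
    | of W =>
      induction W using Quotient.inductionOn with | _ W
      induction hx using AddSubgroup.closure_induction with
      | zero => rw [mul_zero]; exact zero_mem _
      | neg x _ ih => rw [mul_neg]; exact neg_mem ih
      | add x y _ _ ihx ihy => rw [mul_add]; exact add_mem ihx ihy
      | mem r hr =>
        obtain ⟨S, T, rfl⟩ := hr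
        refine AddSubgroup.subset_closure ⟨W.prod S, W.prod T, ?_⟩
        change FreeAbelianGroup.of (GSetClass.mk W) * _ = _
        rw [mul_sub, mul_add, ← FreeAbelianGroup.of_mul, ← FreeAbelianGroup.of_mul,
          ← FreeAbelianGroup.of_mul]
        have h : GSetClass.mk W * GSetClass.mk (S.sum T) =
            GSetClass.mk ((W.prod S).sum (W.prod T)) := by
          refine Quotient.sound ⟨Equiv.prodSumDistrib W S T, ?_⟩
          rintro g ⟨w, s | t⟩ <;> rfl
        rw [h]
        rfl

/-- The Burnside ring of the topological group `G`. -/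
abbrev Burnside : Type (u + 1) := FreeAbelianGroup (GSetClass G) ⧸ burnsideIdeal G

variable {G}

/-- The class of a finite continuous `G`-set in the Burnside ring. -/
def FinGSet.cls (S : FinGSet G) : Burnside G :=
  Ideal.Quotient.mk (burnsideIdeal G) (.of (GSetClass.mk S))

/-- The element `ρ_i(S) = ∑_{t = 1}^{i} ∑_{i_1 + ⋯ + i_t = i, i_s ≥ 1} (-1)^t [P_{i_t, …, i_1}(S)]`
of the Burnside ring. -/
def rho (i : ℕ) (S : FinGSet G) : Burnside G :=
  ∑ t ∈ Finset.Icc 1 i, ∑ a ∈ (Finset.Nat.antidiagonalTuple t i).filter (fun a => ∀ s, 1 ≤ a s),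
    (-1) ^ t * (S.tuples a).cls

end Burnside


theorem cls_specVar_congr {k : Type u} [Field k] {A B : Type u} [CommRing A] [Algebra k A]
    [Algebra.FiniteType k A] [CommRing B] [Algebra k B] [Algebra.FiniteType k B] (e : A ≃ₐ[k] B) :
    cls (specVar k A) = cls (specVar k B) := by
  refine cls_eq_of_iso ((IsVariety k).isoMk (Over.isoMk
    (Scheme.Spec.mapIso (e.symm.toRingEquiv.toCommRingCatIso).op) ?_))
  change Spec.map _ ≫ Spec.map _ = Spec.map _
  rw [← Spec.map_comp]
  congr 1
  ext x
  exact e.symm.commutes x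

theorem cls_specVar_prod {k : Type u} [Field k] {A B : Type u} [CommRing A] [Algebra k A]
    [Algebra.FiniteType k A] [CommRing B] [Algebra k B] [Algebra.FiniteType k B] :
    cls (specVar k (A × B)) = cls (specVar k A) + cls (specVar k B) := by
  refine IsScissor.cls_eq ⟨ObjectProperty.homMk (Over.homMk
    (Spec.map (CommRingCat.ofHom (RingHom.snd A B))) ?_), ObjectProperty.homMk (Over.homMk
    (Spec.map (CommRingCat.ofHom (RingHom.fst A B))) ?_), ?_, ?_, ?_⟩
  · change Spec.map _ ≫ Spec.map _ = Spec.map _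
    rw [← Spec.map_comp]
    rfl
  · change Spec.map _ ≫ Spec.map _ = Spec.map _
    rw [← Spec.map_comp]
    rfl
  · exact IsClosedImmersion.spec_of_surjective _ Prod.snd_surjective
  · let _ := (RingHom.fst A B).toAlgebra
    exact IsOpenImmersion.of_isLocalization (R := A × B) (S := A) (1, 0)
  · change Set.range (PrimeSpectrum.comap (RingHom.fst A B)) =
      (Set.range (PrimeSpectrum.comap (RingHom.snd A B)))ᶜ
    ext x
    simp only [PrimeSpectrum.range_comap_fst, PrimeSpectrum.range_comap_snd, Set.mem_compl_iff,
      PrimeSpectrum.mem_zeroLocus]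
    have hx : (1, 0) * (0, 1) ∈ x.asIdeal := by
      rw [show ((1, 0) * (0, 1) : A × B) = 0 by ext <;> simp]
      exact zero_mem _
    have h1 : ¬ ((1, 0) ∈ x.asIdeal ∧ (0, 1) ∈ x.asIdeal) := fun h =>
      x.isPrime.ne_top ((Ideal.eq_top_iff_one _).mpr (by
        rw [show (1 : A × B) = (1, 0) + (0, 1) by ext <;> simp]
        exact add_mem h.1 h.2))
    constructor
    · intro h h'
      exact h1 ⟨h' (by simp [RingHom.mem_ker]), h (by simp [RingHom.mem_ker])⟩
    · intro h
      rcases x.isPrime.mem_or_mem hx with h2 | h2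
      · refine absurd ?_ h
        rintro ⟨a, b⟩ hb
        rw [SetLike.mem_coe, RingHom.mem_ker] at hb
        obtain rfl : b = 0 := hb
        simpa using x.asIdeal.mul_mem_left (a, 0) h2
      · rintro ⟨a, b⟩ hb
        rw [SetLike.mem_coe, RingHom.mem_ker] at hb
        obtain rfl : a = 0 := hb
        simpa using x.asIdeal.mul_mem_left (0, b) h2

section Galois

variable (k : Type u) [Field k] (K : Type u) [Field K] [Algebra k K]

/-- The `k`-algebra `Hom_G(S, K)` of `G`-equivariant maps from the `G`-set `S` to `K`, where
`G = Gal(K/k)`, with pointwise operations. -/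
def equivariantMaps (S : FinGSet (K ≃ₐ[k] K)) : Subalgebra k (S → K) where
  carrier := {f | ∀ (g : K ≃ₐ[k] K) (s : S), f (g • s) = g (f s)}
  mul_mem' := fun ha hb g s => by simp [ha g s, hb g s]
  add_mem' := fun ha hb g s => by simp [ha g s, hb g s]
  algebraMap_mem' := fun c g s => by simp

instance [IsSepClosure k K] (S : FinGSet (K ≃ₐ[k] K)) :
    Module.Finite k (equivariantMaps k K S) := by
  let F : S → IntermediateField k K := fun s =>
    IntermediateField.fixedField (MulAction.stabilizer (K ≃ₐ[k] K) s)
  have hF : ∀ s, FiniteDimensional k (F s) := fun s => by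
    rw [← InfiniteGalois.isOpen_iff_finite]
    exact Subgroup.isOpen_mono ((IntermediateField.le_iff_le _ _).mp le_rfl)
      (S.isOpen_stabilizer s)
  let φ : equivariantMaps k K S →ₗ[k] (∀ s, F s) :=
    { toFun := fun f s => ⟨f.1 s, fun g => by
        have h := f.2 g.1 s
        rw [MulAction.mem_stabilizer_iff.mp g.2] at h
        exact h.symm⟩
      map_add' := fun _ _ => rfl
      map_smul' := fun _ _ => rfl }
  have _ := Fintype.ofFinite S
  refine FiniteDimensional.of_injective φ fun f g h => Subtype.ext <| funext fun s => ?_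
  exact congrArg Subtype.val (congrFun h s)

/-- An isomorphism of `G`-sets induces an isomorphism of the algebras of equivariant maps. -/
def equivariantMapsCongr {S T : FinGSet (K ≃ₐ[k] K)} (e : S ≃ T)
    (he : ∀ (g : K ≃ₐ[k] K) (s : S), e (g • s) = g • e s) :
    equivariantMaps k K T ≃ₐ[k] equivariantMaps k K S where
  toFun f := ⟨fun s => f.1 (e s), fun g s => by
    change f.1 (e (g • s)) = g (f.1 (e s))
    rw [he]
    exact f.2 g (e s)⟩
  invFun f := ⟨fun t => f.1 (e.symm t), fun g t => by
    change f.1 (e.symm (g • t)) = g (f.1 (e.symm t))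
    rw [← f.2, show e.symm (g • t) = g • e.symm t by
      rw [Equiv.symm_apply_eq, he, Equiv.apply_symm_apply]]⟩
  left_inv f := Subtype.ext <| funext fun t => by simp
  right_inv f := Subtype.ext <| funext fun s => by simp
  map_mul' _ _ := rfl
  map_add' _ _ := rfl
  commutes' _ := rfl

/-- Equivariant maps out of a disjoint union are pairs of equivariant maps. -/
def equivariantMapsSum (S T : FinGSet (K ≃ₐ[k] K)) :
    equivariantMaps k K (S.sum T) ≃ₐ[k] equivariantMaps k K S × equivariantMaps k K T where
  toFun f := (⟨fun s => f.1 (Sum.inl s), fun g s => f.2 g (Sum.inl s)⟩,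
    ⟨fun t => f.1 (Sum.inr t), fun g t => f.2 g (Sum.inr t)⟩)
  invFun p := ⟨fun x => Sum.elim p.1.1 p.2.1 x, by
    rintro g (s | t)
    · exact p.1.2 g s
    · exact p.2.2 g t⟩
  left_inv f := Subtype.ext <| funext fun x => by rcases x with s | t <;> rfl
  right_inv _ := rfl
  map_mul' _ _ := rfl
  map_add' _ _ := rfl
  commutes' _ := rfl

/-- The class of `Spec Hom_G(S, K)`, as a function of the isomorphism class of `S`. -/
noncomputable def artClass [IsSepClosure k K] : GSetClass (K ≃ₐ[k] K) → K0Var k :=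
  Quotient.lift (fun S : FinGSet (K ≃ₐ[k] K) => cls (specVar k (equivariantMaps k K S))) (by
    intro S T h
    obtain ⟨e, he⟩ : S.Iso T := h
    exact (cls_specVar_congr (equivariantMapsCongr k K e he)).symm)

/-- The homomorphism `art_k` from the Burnside ring of the absolute Galois group `G = Gal(K/k)`,
where `K` is a separable closure of `k`, to the Grothendieck ring of varieties over `k`. It sends
the class of the `G`-set `S` to the class of `Spec` of the `k`-algebra `Hom_G(S, K)`. -/
noncomputable def art [IsSepClosure k K] : Burnside (K ≃ₐ[k] K) →+ K0Var k :=
  QuotientAddGroup.lift (burnsideIdeal (K ≃ₐ[k] K)).toAddSubgroup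
    (FreeAbelianGroup.lift (artClass k K))
    (by
      change AddSubgroup.closure _ ≤ _
      rw [AddSubgroup.closure_le]
      rintro _ ⟨S, T, rfl⟩
      rw [SetLike.mem_coe, AddMonoidHom.mem_ker, map_sub, map_add, sub_eq_zero]
      simp only [FreeAbelianGroup.lift_apply_of]
      exact (cls_specVar_congr (equivariantMapsSum k K S T)).trans cls_specVar_prod)

theorem art_cls [IsSepClosure k K] (S : FinGSet (K ≃ₐ[k] K)) :
    art k K S.cls = cls (specVar k (equivariantMaps k K S)) :=
  rfl

/-- The finite `k`-algebra `L` corresponds to the finite `G`-set `S`, where `G = Gal(K/k)`: `S` is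
isomorphic as a `G`-set to `Hom_k(L, K)`, on which `σ ∈ G` acts by `f ↦ σ ∘ f`. -/
def Corresponds (L : Type u) [CommRing L] [Algebra k L] (S : FinGSet (K ≃ₐ[k] K)) : Prop :=
  ∃ e : S ≃ (L →ₐ[k] K), ∀ (σ : K ≃ₐ[k] K) (s : S), e (σ • s) = (σ : K →ₐ[k] K).comp (e s)

end Galois

section Torus

open TensorProduct

variable (k : Type u) [Field k] (L : Type u) [CommRing L] [Algebra k L] [Module.Finite k L]

/-- For a `k`-algebra `R` and a tuple `x` of elements of `R`, the element of `R ⊗ L` with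
coordinates `x` in the chosen basis of `L`. -/
noncomputable def pointOf {R : Type u} [CommRing R] [Algebra k R]
    (x : Fin (Module.finrank k L) → R) : R ⊗[k] L :=
  ∑ i, x i ⊗ₜ[k] Module.finBasis k L i

/-- The norm form of `L`: the norm of the generic element `∑ X_i b_i`, where `b` is a basis of `L`,
as a polynomial in the coordinates `X_i`. -/
noncomputable def normForm : MvPolynomial (Fin (Module.finrank k L)) k :=
  Algebra.norm (MvPolynomial (Fin (Module.finrank k L)) k)
    (pointOf k L (R := MvPolynomial (Fin (Module.finrank k L)) k) MvPolynomial.X)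

/-- The torus `L^*`, i.e. the variety `Spec k[X_1, …, X_n, 1/N]` over `k`, where `N` is the norm
form of `L`: the open subscheme of the affine space of `L` where the norm is invertible. -/
noncomputable def unitTorus : Var k := specVar k (Localization.Away (normForm k L))

theorem bijective_pointOf {R : Type u} [CommRing R] [Algebra k R] :
    Function.Bijective (pointOf k L (R := R)) := by
  have h : ∀ x, pointOf k L x =
      (Algebra.TensorProduct.basis R (Module.finBasis k L)).equivFun.symm x := fun x => by
    simp [pointOf, Module.Basis.equivFun_symm_apply, TensorProduct.smul_tmul']
  rw [show pointOf k L (R := R) = _ from funext h]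
  exact LinearEquiv.bijective _

theorem norm_pointOf {R : Type u} [CommRing R] [Algebra k R]
    (x : Fin (Module.finrank k L) → R) :
    Algebra.norm R (pointOf k L x) = MvPolynomial.aeval x (normForm k L) := by
  rw [normForm, Algebra.norm_eq_matrix_det (Algebra.TensorProduct.basis R (Module.finBasis k L)),
    Algebra.norm_eq_matrix_det (Algebra.TensorProduct.basis _ (Module.finBasis k L)),
    AlgHom.map_det]
  congr 1
  ext i j
  rw [AlgHom.mapMatrix_apply, Matrix.map_apply, Algebra.leftMulMatrix_eq_repr_mul,
    Algebra.leftMulMatrix_eq_repr_mul]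
  simp [pointOf, Finset.sum_mul, map_sum]

theorem isUnit_pointOf_iff {R : Type u} [CommRing R] [Algebra k R]
    (x : Fin (Module.finrank k L) → R) :
    IsUnit (pointOf k L x) ↔ IsUnit (MvPolynomial.aeval x (normForm k L)) := by
  rw [← norm_pointOf]
  refine ⟨fun h => h.map _, fun h => ?_⟩
  rw [Algebra.norm_apply, ← LinearMap.isUnit_iff_isUnit_det, Module.End.isUnit_iff] at h
  obtain ⟨y, hy⟩ := h.2 1
  exact IsUnit.of_mul_eq_one y hy

/-- The functor of points of `L^*`: for every `k`-algebra `R`, evaluation of the coordinates is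
a bijection from the `R`-points of `L^*` to the units of `R ⊗ L`. -/
theorem unitTorus_points (R : Type u) [CommRing R] [Algebra k R] :
    Set.BijOn (fun φ : Localization.Away (normForm k L) →ₐ[k] R =>
        pointOf k L fun i => φ (algebraMap
          (MvPolynomial (Fin (Module.finrank k L)) k) _ (MvPolynomial.X i)))
      Set.univ {x : R ⊗[k] L | IsUnit x} := by
  refine ⟨fun φ _ => ?_, fun φ _ ψ _ h => ?_, fun x hx => ?_⟩
  · rw [Set.mem_ofPred_eq, isUnit_pointOf_iff]
    have h : MvPolynomial.aeval (fun i => φ (algebraMap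
        (MvPolynomial (Fin (Module.finrank k L)) k) _ (MvPolynomial.X i))) =
        φ.comp (IsScalarTower.toAlgHom k (MvPolynomial (Fin (Module.finrank k L)) k) _) := by
      ext i
      simp
    rw [h]
    exact (IsLocalization.Away.algebraMap_isUnit (normForm k L)).map φ
  · have h' := (bijective_pointOf k L).1 h
    refine IsLocalization.algHom_ext (Submonoid.powers (normForm k L)) ?_
    ext i
    exact congrFun h' i
  · obtain ⟨y, rfl⟩ := (bijective_pointOf k L).2 x
    rw [Set.mem_ofPred_eq, isUnit_pointOf_iff] at hx
    refine ⟨IsLocalization.Away.liftAlgHom (S := Localization.Away (normForm k L)) (normForm k L)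
      (f := MvPolynomial.aeval y) hx, trivial, ?_⟩
    simp

end Torus

end GrothendieckVar

/-!
Over the separable closure `K`, the algebra `L` becomes `K ^ S`, and `L^*` becomes the locus in the
affine space `K ^ S` where no coordinate vanishes. More generally, a tuple `F` of disjoint subsets
of `S`, of sizes `a = (a_1, …, a_t)`, gives the coordinate subspace of `K ^ S` where the coordinates
in the union of `F` vanish, and the open torus in it where no other coordinate vanishes. As `F`
varies over the Galois set `P_a(S)`, these form bundles that descend to varieties `V_a ⊇ W_a` over
`k`.

* `V_a` is a trivial vector bundle of rank `n - |a|` over `Spec Hom_G(P_a(S), K)`, so that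
  `[V_a] = art(P_a(S)) 𝕃 ^ (n - |a|)` (`Frame.cls_bundleRing`). An equivariant basis of linear forms
  is obtained from elements of `L`, by independence of characters (`nonempty_frame`).
* Stratifying `V_a` by the number `m` of further coordinates that vanish, the set of these
  coordinates is one more entry of the tuple, so that `[V_a] = [W_a] + ∑_{m ≥ 1} [W_{(m, a)}]`
  (`cls_bundleRing_eq_add_sum`, `isRefinement_tailTuple`). Each stratum is identified with the
  torus bundle `W_{(m, a)}` as a scheme: a function on `V_{(m, a)}`, times the product of the
  coordinates that remain, is the restriction of a function on `V_a`
  (`IsRefinement.exists_restrict_eq`).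
* Unrolling this recursion gives `[W_∅] = ∑_a (-1) ^ t [V_a]` (`eq_sum_of_recursion`), and `W_∅` is
  the unit torus of `L`, since the norm form is the product of the coordinates (`cls_unitTorus`).

All these varieties are affine. Their coordinate rings are described as rings of equivariant
families of polynomials over `K`, so that the arguments take place over `K` and no descent theory is
needed.
-/

namespace GrothendieckVar

/-! ### Classes of affine varieties -/

section Affine

variable {k : Type u} [Field k]

theorem cls_tensor (X Y : Var k) : cls (X ⊗ Y) = cls X * cls Y := by
  rw [cls, cls, cls, Skeleton.toSkeleton_tensorObj, FreeAbelianGroup.of_mul, map_mul]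

variable {A B C R : Type u} [CommRing A] [Algebra k A] [CommRing B] [Algebra k B]
  [CommRing C] [Algebra k C] [CommRing R] [Algebra k R]

open TensorProduct in
theorem cls_specVar_tensorProduct [Algebra.FiniteType k A] [Algebra.FiniteType k B]
    [Algebra.FiniteType k (A ⊗[k] B)] :
    cls (specVar k (A ⊗[k] B)) = cls (specVar k A) * cls (specVar k B) := by
  rw [← cls_tensor]
  refine cls_eq_of_iso ((IsVariety k).isoMk (Over.isoMk (pullbackSpecIso k A B).symm ?_))
  change (pullbackSpecIso k A B).inv ≫ (Limits.pullback.fst _ _ ≫ Spec.map _) = Spec.map _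
  rw [pullbackSpecIso_inv_fst_assoc, ← Spec.map_comp]
  rfl

open Polynomial in
theorem cls_specVar_polynomial [Algebra.FiniteType k A] [Algebra.FiniteType k A[X]] :
    cls (specVar k A[X]) = cls (specVar k A) * lefschetz k := by
  have : Algebra.FiniteType k (TensorProduct k A k[X]) :=
    Algebra.FiniteType.equiv ‹_› (polyEquivTensor k A)
  rw [cls_specVar_congr (polyEquivTensor k A), cls_specVar_tensorProduct, lefschetz]

instance finiteType_mvPolynomial [Algebra.FiniteType k A] (d : ℕ) :
    Algebra.FiniteType k (MvPolynomial (Fin d) A) :=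
  Algebra.FiniteType.trans (S := A) ‹_› inferInstance

theorem cls_specVar_mvPolynomial [Algebra.FiniteType k A] (d : ℕ) :
    cls (specVar k (MvPolynomial (Fin d) A)) = cls (specVar k A) * lefschetz k ^ d := by
  induction d with
  | zero =>
    rw [pow_zero, mul_one]
    exact cls_specVar_congr ((MvPolynomial.isEmptyAlgEquiv A (Fin 0)).restrictScalars k)
  | succ d ih =>
    have : Algebra.FiniteType k (Polynomial (MvPolynomial (Fin d) A)) :=
      Algebra.FiniteType.trans (S := MvPolynomial (Fin d) A) inferInstance inferInstance
    rw [cls_specVar_congr ((MvPolynomial.finSuccEquiv A d).restrictScalars k),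
      cls_specVar_polynomial, ih, pow_succ, mul_assoc]

theorem cls_specVar_eq_one [Algebra.FiniteType k A] (h : Function.Bijective (algebraMap k A)) :
    cls (specVar k A) = 1 := by
  have h1 : (1 : K0Var k) = cls (𝟙_ (Var k)) := by
    rw [cls, ← Skeleton.one_eq]
    rfl
  rw [h1, ← cls_specVar_congr (AlgEquiv.ofBijective (Algebra.ofId k A) h)]
  refine cls_eq_of_iso ((IsVariety k).isoMk (Over.isoMk (Iso.refl _) ?_))
  change 𝟙 _ ≫ 𝟙 _ = Spec.map (𝟙 _)
  simp

theorem cls_specVar_of_subsingleton [Algebra.FiniteType k A] [Subsingleton A] :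
    cls (specVar k A) = 0 := by
  have h := cls_specVar_prod (k := k) (A := A) (B := A)
  rw [cls_specVar_congr (k := k) (A := A × A) (B := A)
    { toFun := fun x => x.1
      invFun := fun x => (x, x)
      left_inv := fun _ => Subsingleton.elim _ _
      right_inv := fun _ => rfl
      map_mul' := fun _ _ => rfl
      map_add' := fun _ _ => rfl
      commutes' := fun _ => rfl }] at h
  simpa using h

/-- If `φ : A → R` is injective and its image contains all multiples of `φ e`, then `A` and `R`
become equal after inverting `e`. -/
theorem isLocalization_away_of_mul_mem_range (φ : A →ₐ[k] R) (hφ : Function.Injective φ) (e : A)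
    (h : ∀ r, ∃ a, φ a = φ e * r) :
    letI := ((algebraMap R (Localization.Away (φ e))).comp φ.toRingHom).toAlgebra
    IsLocalization.Away e (Localization.Away (φ e)) := by
  let := ((algebraMap R (Localization.Away (φ e))).comp φ.toRingHom).toAlgebra
  have hmap : ∀ a, algebraMap A (Localization.Away (φ e)) a =
      algebraMap R (Localization.Away (φ e)) (φ a) := fun _ => rfl
  refine ⟨?_, ?_, ?_⟩
  · rintro ⟨_, n, rfl⟩
    rw [hmap]
    simpa using (IsLocalization.Away.algebraMap_isUnit (S := Localization.Away (φ e)) (φ e)).pow n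
  · intro z
    obtain ⟨n, r, hr⟩ := IsLocalization.Away.surj (φ e) z
    obtain ⟨a, ha⟩ := h r
    refine ⟨⟨a, ⟨e ^ (n + 1), n + 1, rfl⟩⟩, ?_⟩
    simp only [hmap, map_pow, ha, map_mul, ← hr]
    ring
  · intro x y hxy
    rw [hmap, hmap] at hxy
    obtain ⟨⟨_, n, rfl⟩, hc⟩ := (IsLocalization.eq_iff_exists (Submonoid.powers (φ e)) _).mp hxy
    refine ⟨⟨e ^ n, n, rfl⟩, hφ ?_⟩
    simpa using hc

/-- Let `φ : A → R` be injective, `ψ : A → C` surjective and `N ∈ R`. If every multiple of `N`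
lifts along `φ` to `ker ψ`, and `φ` maps `ker ψ` into the multiples of `N`, then `Spec C` is, up to
nilpotents in the ideal defining it, the zero locus in `Spec A` of the lift `e` of `N`, and its
complement is `Spec R[1/N]`. -/
theorem cls_specVar_eq_add_of_injective [Algebra.FiniteType k A] [Algebra.FiniteType k C]
    (φ : A →ₐ[k] R) (hφ : Function.Injective φ) (N : R) [Algebra.FiniteType k R]
    (ψ : A →ₐ[k] C) (hψ : Function.Surjective ψ)
    (hN : ∀ r, ∃ a, ψ a = 0 ∧ φ a = N * r) (hC : ∀ a, ψ a = 0 → N ∣ φ a) :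
    cls (specVar k A) = cls (specVar k (Localization.Away N)) + cls (specVar k C) := by
  obtain ⟨e, he, heN⟩ := hN 1
  rw [mul_one] at heN
  subst heN
  let := ((algebraMap R (Localization.Away (φ e))).comp φ.toRingHom).toAlgebra
  have hloc : IsLocalization.Away e (Localization.Away (φ e)) :=
    isLocalization_away_of_mul_mem_range φ hφ e fun r => (hN r).imp fun _ h => h.2
  refine IsScissor.cls_eq ⟨ObjectProperty.homMk (Over.homMk
    (Spec.map (CommRingCat.ofHom ψ.toRingHom)) ?_), ObjectProperty.homMk (Over.homMk
    (Spec.map (CommRingCat.ofHom (algebraMap A (Localization.Away (φ e))))) ?_), ?_, ?_, ?_⟩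
  · change Spec.map _ ≫ Spec.map _ = Spec.map _
    rw [← Spec.map_comp]
    congr 1
    ext x
    exact ψ.commutes x
  · change Spec.map _ ≫ Spec.map _ = Spec.map _
    rw [← Spec.map_comp]
    congr 1
    ext x
    change algebraMap R _ (φ (algebraMap k A x)) = algebraMap k _ x
    rw [φ.commutes, ← IsScalarTower.algebraMap_apply]
  · exact IsClosedImmersion.spec_of_surjective _ hψ
  · exact IsOpenImmersion.of_isLocalization e
  · change Set.range (PrimeSpectrum.comap (algebraMap A (Localization.Away (φ e)))) =
      (Set.range (PrimeSpectrum.comap ψ.toRingHom))ᶜ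
    rw [PrimeSpectrum.localization_away_comap_range _ e,
      range_comap_of_surjective _ _ hψ]
    ext x
    simp only [SetLike.mem_coe, PrimeSpectrum.mem_basicOpen, Set.mem_compl_iff,
      PrimeSpectrum.mem_zeroLocus, not_iff_not]
    constructor
    · intro hx a ha
      have ha' : ψ a = 0 := ha
      obtain ⟨h, hh⟩ := hC a ha'
      obtain ⟨b, -, hb⟩ := hN (h ^ 2)
      -- The lift of `N * h` need not be divisible by `e` in `A`, but the lift of its square is.
      have : a ^ 2 = e * b := hφ (by rw [map_pow, map_mul, hh, hb]; ring)
      refine x.isPrime.mem_of_pow_mem 2 ?_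
      rw [this]
      exact x.asIdeal.mul_mem_right _ hx
    · intro hx
      exact hx he

/-- The form of `cls_specVar_eq_add_of_injective` for nested closed subschemes `V(J) ⊆ V(I)` of
`Spec A`, where `I` is given as the kernel of `φ : A → R`. -/
theorem cls_specVar_quotient_eq_add [Algebra.FiniteType k A] (φ : A →ₐ[k] R) (N : R)
    [Algebra.FiniteType k R] {I J : Ideal A} (hI : RingHom.ker φ = I)
    (hIJ : I ≤ J) (hN : ∀ r, ∃ a ∈ J, φ a = N * r) (hJ : ∀ a ∈ J, N ∣ φ a) :
    cls (specVar k (A ⧸ I)) =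
      cls (specVar k (Localization.Away N)) + cls (specVar k (A ⧸ J)) := by
  subst hI
  refine cls_specVar_eq_add_of_injective (Ideal.kerLiftAlg φ) (Ideal.kerLiftAlg_injective φ) N
    (Ideal.Quotient.factorₐ k hIJ) (Ideal.Quotient.factor_surjective hIJ) ?_ ?_
  · intro r
    obtain ⟨a, ha, h⟩ := hN r
    exact ⟨Ideal.Quotient.mk _ a, Ideal.Quotient.eq_zero_iff_mem.mpr ha, h⟩
  · intro b hb
    obtain ⟨a, rfl⟩ := Ideal.Quotient.mk_surjective b
    exact hJ a (Ideal.Quotient.eq_zero_iff_mem.mp hb)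

end Affine

/-! ### Coordinate subspaces and their equivariant coordinate rings -/

section CoordinateSubspaces

variable {k : Type u} [Field k] {K : Type u} [Field K] [Algebra k K]

noncomputable instance {G : Type u} [Group G] [TopologicalSpace G] (S : FinGSet G) : Fintype S :=
  Fintype.ofFinite S

variable {S P : FinGSet (K ≃ₐ[k] K)}

/-- The semilinear action of a Galois automorphism `g` on the coordinate ring `K[X_s : s ∈ S]` of
the affine space `K ^ S`: it acts on coefficients by `g` and maps `X_s` to `X_{g s}`. -/
noncomputable def twist (S : FinGSet (K ≃ₐ[k] K)) (g : K ≃ₐ[k] K) :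
    MvPolynomial S K →+* MvPolynomial S K :=
  MvPolynomial.eval₂Hom (MvPolynomial.C.comp (g : K →+* K)) fun s => MvPolynomial.X (g • s)

@[simp]
theorem twist_C (g : K ≃ₐ[k] K) (c : K) :
    twist S g (MvPolynomial.C c) = MvPolynomial.C (g c) := by
  simp [twist]

@[simp]
theorem twist_X (g : K ≃ₐ[k] K) (s : S) :
    twist S g (MvPolynomial.X s) = MvPolynomial.X (g • s) := by
  simp [twist]

open scoped Classical in
/-- Restriction of polynomial functions to the coordinate subspace on which all coordinates outside
`D` vanish. The coordinate ring of this subspace is encoded as the subring of polynomials in the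
variables `X_s`, `s ∈ D`, i.e. the polynomials fixed by `coordProj D`. -/
noncomputable def coordProj (D : Set S) : MvPolynomial S K →ₐ[K] MvPolynomial S K :=
  MvPolynomial.aeval fun s => if s ∈ D then MvPolynomial.X s else 0

theorem coordProj_X_of_mem {D : Set S} {s : S} (h : s ∈ D) :
    coordProj D (MvPolynomial.X s : MvPolynomial S K) = MvPolynomial.X s := by
  simp [coordProj, h]

theorem coordProj_X_of_notMem {D : Set S} {s : S} (h : s ∉ D) :
    coordProj D (MvPolynomial.X s : MvPolynomial S K) = 0 := by
  simp [coordProj, h]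

theorem coordProj_coordProj (D E : Set S) (f : MvPolynomial S K) :
    coordProj D (coordProj E f) = coordProj (D ∩ E) f := by
  change ((coordProj D).comp (coordProj E)) f = _
  congr 1
  ext1 s
  by_cases hE : s ∈ E <;> by_cases hD : s ∈ D <;> simp [coordProj, hE, hD]

theorem coordProj_coordProj_of_subset {D E : Set S} (h : D ⊆ E) (f : MvPolynomial S K) :
    coordProj D (coordProj E f) = coordProj D f := by
  rw [coordProj_coordProj, Set.inter_eq_left.mpr h]

theorem twist_coordProj (g : K ≃ₐ[k] K) {D D' : Set S} (h : ∀ s, g • s ∈ D' ↔ s ∈ D)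
    (f : MvPolynomial S K) :
    twist S g (coordProj D f) = coordProj D' (twist S g f) := by
  change ((twist S g).comp (coordProj D).toRingHom) f =
    ((coordProj D').toRingHom.comp (twist S g)) f
  congr 1
  refine MvPolynomial.ringHom_ext (fun c => ?_) fun s => ?_
  · simp [coordProj, MvPolynomial.algebraMap_eq]
  · by_cases hs : s ∈ D <;> simp [coordProj, hs, h]

theorem X_dvd_sub_coordProj (s : S) (f : MvPolynomial S K) :
    MvPolynomial.X s ∣ f - coordProj {s}ᶜ f := by
  induction f using MvPolynomial.induction_on with
  | C a => simp [coordProj, MvPolynomial.algebraMap_eq]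
  | add p q hp hq =>
    rw [map_add, add_sub_add_comm]
    exact dvd_add hp hq
  | mul_X p t hp =>
    rw [map_mul]
    by_cases h : t = s
    · subst h
      rw [coordProj_X_of_notMem (by simp), mul_zero, sub_zero]
      exact dvd_mul_left _ _
    · rw [coordProj_X_of_mem (by simpa using h), ← sub_mul]
      exact hp.mul_right _

open scoped Classical in
/-- The product of the coordinates `X_s` with `s ∈ D`. -/
noncomputable def coordProd (K : Type u) [Field K] [Algebra k K] {S : FinGSet (K ≃ₐ[k] K)}
    (D : Set S) : MvPolynomial S K :=
  ∏ s with s ∈ D, MvPolynomial.X s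

theorem coordProd_ne_zero (D : Set S) : coordProd K D ≠ 0 :=
  Finset.prod_ne_zero_iff.mpr fun _ _ => MvPolynomial.X_ne_zero _

theorem twist_coordProd (g : K ≃ₐ[k] K) {D D' : Set S} (h : ∀ s, g • s ∈ D' ↔ s ∈ D) :
    twist S g (coordProd K D) = coordProd K D' := by
  classical
  rw [coordProd, coordProd, map_prod]
  refine Finset.prod_equiv (MulAction.toPerm g) (fun s => ?_) fun s _ => ?_
  · simp [h]
  · simp

theorem coordProj_coordProd_of_subset {D E : Set S} (h : D ⊆ E) :
    coordProj E (coordProd K D) = coordProd K D := by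
  classical
  rw [coordProd, map_prod]
  refine Finset.prod_congr rfl fun s hs => coordProj_X_of_mem (h ?_)
  simpa using hs

theorem coordProj_coordProd_of_not_subset {D E : Set S} (h : ¬ D ⊆ E) :
    coordProj E (coordProd K D) = 0 := by
  classical
  obtain ⟨s, hs, hs'⟩ := Set.not_subset.mp h
  rw [coordProd, map_prod]
  exact Finset.prod_eq_zero (i := s) (by simpa using hs) (coordProj_X_of_notMem hs')

/-- A function on the coordinate subspace of `D` that vanishes on each of its coordinate hyperplanes
is divisible by the product of the coordinates. -/
theorem coordProd_dvd {D : Set S} {f : MvPolynomial S K} (hf : coordProj D f = f)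
    (h : ∀ s ∈ D, coordProj (D \ {s}) f = 0) : coordProd K D ∣ f := by
  classical
  refine Finset.prod_dvd_of_isRelPrime (fun s _ t _ hst => ?_) fun s hs => ?_
  · refine (Irreducible.isRelPrime_iff_not_dvd MvPolynomial.X_prime.irreducible).mpr ?_
    rw [MvPolynomial.X_dvd_X]
    simpa using hst
  · have h1 := X_dvd_sub_coordProj s f
    have h2 : coordProj {s}ᶜ f = 0 := by
      rw [← h s (by simpa using hs), Set.sdiff_eq, Set.inter_comm, ← coordProj_coordProj, hf]
    rwa [h2, sub_zero] at h1

/-- A family of subsets `C p ⊆ S`, indexed by a Galois set `P`, with `C (g p) = g (C p)`. -/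
def IsEquivariantFamily (C : P → Set S) : Prop :=
  ∀ (g : K ≃ₐ[k] K) (p : P) (s : S), g • s ∈ C (g • p) ↔ s ∈ C p

/-- The coordinate ring over `k` of the bundle over `P` whose fibre at `p` is the coordinate
subspace of `K ^ S` with coordinates `X_s`, `s ∈ C p`. The descent from `K` to `k` is built in: the
elements are the Galois-equivariant families of functions on the fibres. -/
def bundleRing (C : P → Set S) : Subalgebra k (P → MvPolynomial S K) where
  carrier := {f | (∀ p, coordProj (C p) (f p) = f p) ∧
    ∀ (g : K ≃ₐ[k] K) (p : P), f (g • p) = twist S g (f p)}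
  mul_mem' := fun ha hb =>
    ⟨fun p => by simp [ha.1 p, hb.1 p], fun g p => by simp [ha.2 g p, hb.2 g p]⟩
  add_mem' := fun ha hb =>
    ⟨fun p => by simp [ha.1 p, hb.1 p], fun g p => by simp [ha.2 g p, hb.2 g p]⟩
  algebraMap_mem' := fun c =>
    ⟨fun p => by simp [MvPolynomial.algebraMap_apply, coordProj],
      fun g p => by simp [MvPolynomial.algebraMap_apply]⟩

/-- The function on the bundle of coordinate subspaces given on each fibre by the product of all
coordinates. Its nonvanishing locus is the bundle of the open tori of the fibres. -/
noncomputable def coordNorm {C : P → Set S} (hC : IsEquivariantFamily C) : bundleRing C :=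
  ⟨fun p => coordProd K (C p), fun _ => coordProj_coordProd_of_subset subset_rfl,
    fun g p => (twist_coordProd g (hC g p)).symm⟩

end CoordinateSubspaces

/-! ### Trivialization of bundles of coordinate subspaces -/

section Frames

variable {k : Type u} [Field k] {K : Type u} [Field K] [Algebra k K]
variable {S P : FinGSet (K ≃ₐ[k] K)}

open scoped Classical in
/-- A Galois-equivariant family of linear coordinate systems on the bundle of coordinate subspaces
given by `C`: on the fibre at `p`, linear forms `∑ s, toCoord p j s * X_s` for `j < d`, which form a
basis of the linear forms in the variables `X_s`, `s ∈ C p`. The inverse change of coordinates is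
part of the data. The matrices are indexed by all of `S`; the two equations force the entries of
`toCoord` outside `C p` to vanish, as `toCoord * ofCoord * toCoord = toCoord`. -/
structure Frame (C : P → Set S) (d : ℕ) where
  /-- the coefficient of `X_s` in the `j`-th linear form on the fibre at `p` -/
  toCoord : P → Fin d → S → K
  /-- the coefficient of the `j`-th linear form in the expression of `X_s`, for `s ∈ C p` -/
  ofCoord : P → S → Fin d → K
  toCoord_smul : ∀ (g : K ≃ₐ[k] K) (p : P) (j : Fin d) (s : S),
    toCoord (g • p) j (g • s) = g (toCoord p j s)
  toCoord_mul_ofCoord : ∀ p i j, ∑ s, toCoord p j s * ofCoord p s i = if j = i then 1 else 0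
  ofCoord_mul_toCoord : ∀ p s s',
    ∑ j, ofCoord p s j * toCoord p j s' = if s = s' ∧ s ∈ C p then 1 else 0

namespace Frame

variable {C : P → Set S} {d : ℕ} (B : Frame C d)

/-- The `j`-th linear coordinate of the frame on the fibre at `p`. -/
noncomputable def linearForm (p : P) (j : Fin d) : MvPolynomial S K :=
  ∑ s, MvPolynomial.C (B.toCoord p j s) * MvPolynomial.X s

theorem linearForm_smul (g : K ≃ₐ[k] K) (p : P) (j : Fin d) :
    B.linearForm (g • p) j = twist S g (B.linearForm p j) := by
  rw [linearForm, linearForm, map_sum]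
  refine (Finset.sum_equiv (MulAction.toPerm g) (by simp) fun s _ => ?_).symm
  simp [B.toCoord_smul]

/-- Substitution of the linear coordinates at `p` for the variables. -/
noncomputable def subst (p : P) : MvPolynomial (Fin d) K →ₐ[K] MvPolynomial S K :=
  MvPolynomial.aeval (B.linearForm p)

/-- The inverse of `Frame.subst` on polynomials in the variables `X_s`, `s ∈ C p`. It sends the
other variables to `0`. -/
noncomputable def invSubst (p : P) : MvPolynomial S K →ₐ[K] MvPolynomial (Fin d) K :=
  MvPolynomial.aeval fun s => ∑ j, MvPolynomial.C (B.ofCoord p s j) * MvPolynomial.X j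

theorem invSubst_subst (p : P) (F : MvPolynomial (Fin d) K) : B.invSubst p (B.subst p F) = F := by
  classical
  change ((B.invSubst p).comp (B.subst p)) F = AlgHom.id K _ F
  congr 1
  ext1 j
  simp only [subst, invSubst, linearForm, AlgHom.comp_apply, MvPolynomial.aeval_X, map_sum,
    map_mul, MvPolynomial.algHom_C, MvPolynomial.algebraMap_eq]
  simp only [Finset.mul_sum, ← mul_assoc, ← MvPolynomial.C_mul]
  rw [Finset.sum_comm]
  simp_rw [← Finset.sum_mul, ← map_sum, B.toCoord_mul_ofCoord]
  simp

theorem subst_invSubst (p : P) (f : MvPolynomial S K) :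
    B.subst p (B.invSubst p f) = coordProj (C p) f := by
  classical
  change ((B.subst p).comp (B.invSubst p)) f = _
  congr 1
  ext1 s
  simp only [subst, invSubst, AlgHom.comp_apply, MvPolynomial.aeval_X, map_sum,
    map_mul, MvPolynomial.algHom_C, MvPolynomial.algebraMap_eq]
  simp only [linearForm, Finset.mul_sum, ← mul_assoc, ← MvPolynomial.C_mul]
  rw [Finset.sum_comm]
  simp_rw [← Finset.sum_mul, ← map_sum, B.ofCoord_mul_toCoord]
  by_cases h : s ∈ C p <;> simp [h, coordProj]

theorem coordProj_subst (p : P) (F : MvPolynomial (Fin d) K) :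
    coordProj (C p) (B.subst p F) = B.subst p F := by
  rw [← subst_invSubst, invSubst_subst]

theorem subst_injective (p : P) : Function.Injective (B.subst p) :=
  Function.LeftInverse.injective (B.invSubst_subst p)

theorem subst_smul (g : K ≃ₐ[k] K) (p : P) (F : MvPolynomial (Fin d) K) :
    B.subst (g • p) (MvPolynomial.map (g : K →+* K) F) = twist S g (B.subst p F) := by
  change ((B.subst (g • p)).toRingHom.comp (MvPolynomial.map (g : K →+* K))) F =
    ((twist S g).comp (B.subst p).toRingHom) F
  congr 1
  refine MvPolynomial.ringHom_ext (fun c => ?_) fun j => ?_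
  · simp [subst, MvPolynomial.algebraMap_eq]
  · simp [subst, linearForm_smul]

/-- Evaluation of equivariant maps at the point `p`. -/
noncomputable def evalAt (P : FinGSet (K ≃ₐ[k] K)) (p : P) : equivariantMaps k K P →ₐ[k] K :=
  (Pi.evalAlgHom k (fun _ : P => K) p).comp (equivariantMaps k K P).val

/-- The comparison map from polynomials over `Hom_G(P, K)` to the coordinate ring of the bundle: on
the fibre at `p`, evaluate the coefficients at `p` and substitute the linear coordinates. -/
noncomputable def toBundleRing :
    MvPolynomial (Fin d) (equivariantMaps k K P) →ₐ[k] bundleRing C :=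
  (AlgHom.pi fun p =>
    ((B.subst p).restrictScalars k).comp (MvPolynomial.mapAlgHom (evalAt P p))).codRestrict _
    fun F => ⟨fun p => B.coordProj_subst p _, fun g p => by
      refine Eq.trans ?_ (B.subst_smul g p (MvPolynomial.map (evalAt P p).toRingHom F))
      change B.subst (g • p) (MvPolynomial.map (evalAt P (g • p)).toRingHom F) = _
      rw [MvPolynomial.map_map]
      exact congrArg (fun φ : equivariantMaps k K P →+* K =>
        B.subst (g • p) (MvPolynomial.map φ F)) (RingHom.ext fun f => f.2 g p)⟩

theorem toBundleRing_apply (F : MvPolynomial (Fin d) (equivariantMaps k K P)) (p : P) :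
    (B.toBundleRing F).1 p = B.subst p (MvPolynomial.map (evalAt P p).toRingHom F) :=
  rfl

/-- For surjectivity, an equivariant family of functions is rewritten in the linear coordinates of
the frame; these are equivariant, so each coefficient is an equivariant map. -/
theorem toBundleRing_bijective : Function.Bijective B.toBundleRing := by
  classical
  constructor
  · intro F F' h
    ext m p
    have h1 := congrFun (congrArg Subtype.val h) p
    rw [toBundleRing_apply, toBundleRing_apply] at h1
    have h2 := congrArg (MvPolynomial.coeff m) (B.subst_injective p h1)
    rw [MvPolynomial.coeff_map, MvPolynomial.coeff_map] at h2
    exact h2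
  · intro f
    let F : P → MvPolynomial (Fin d) K := fun p => B.invSubst p (f.1 p)
    have hF : ∀ (g : K ≃ₐ[k] K) p, F (g • p) = MvPolynomial.map (g : K →+* K) (F p) := by
      intro g p
      apply B.subst_injective
      rw [subst_smul, subst_invSubst, subst_invSubst, f.2.1, f.2.1, f.2.2]
    let c : (Fin d →₀ ℕ) → equivariantMaps k K P := fun m =>
      ⟨fun p => (F p).coeff m, fun g p => by simp [hF, MvPolynomial.coeff_map]⟩
    refine ⟨∑ m ∈ Finset.univ.biUnion fun p => (F p).support, MvPolynomial.monomial m (c m),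
      Subtype.ext <| funext fun p => ?_⟩
    rw [toBundleRing_apply]
    have h : MvPolynomial.map (evalAt P p).toRingHom (∑ m ∈ Finset.univ.biUnion fun p =>
        (F p).support, MvPolynomial.monomial m (c m)) = F p := by
      simp only [map_sum, MvPolynomial.map_monomial]
      conv_rhs => rw [(F p).as_sum]
      refine (Finset.sum_subset (Finset.subset_biUnion_of_mem (fun p => (F p).support)
        (Finset.mem_univ p)) fun m _ hm => ?_).symm
      change MvPolynomial.monomial m ((F p).coeff m) = 0
      rw [MvPolynomial.notMem_support_iff.mp hm, map_zero]
    rw [h, subst_invSubst, f.2.1]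

/-- A frame trivializes the bundle of coordinate subspaces: it is an affine space over
`Spec Hom_G(P, K)`. -/
noncomputable def bundleRingEquiv :
    MvPolynomial (Fin d) (equivariantMaps k K P) ≃ₐ[k] bundleRing C :=
  AlgEquiv.ofBijective B.toBundleRing B.toBundleRing_bijective

theorem finiteType_bundleRing [IsSepClosure k K] (B : Frame C d) :
    Algebra.FiniteType k (bundleRing C) :=
  Algebra.FiniteType.equiv inferInstance B.bundleRingEquiv

theorem cls_bundleRing [IsSepClosure k K] (B : Frame C d)
    [Algebra.FiniteType k (bundleRing C)] :
    cls (specVar k (bundleRing C)) = art k K P.cls * lefschetz k ^ d := by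
  rw [art_cls, ← cls_specVar_mvPolynomial]
  exact (cls_specVar_congr B.bundleRingEquiv).symm

end Frame

end Frames

/-! ### Separating points by algebra homomorphisms, and existence of frames -/

section Frames

variable {k : Type u} [Field k] {K : Type u} [Field K] [Algebra k K]
variable {S P : FinGSet (K ≃ₐ[k] K)}
variable {L : Type u} [CommRing L] [Algebra k L]

/-- The dual form of Dedekind's independence of characters: the vectors of values `(χ_i(l))_i`, for
`l ∈ L`, span `K ^ ι`. -/
theorem span_range_eval_eq_top {ι : Type*} [Finite ι] (χ : ι → (L →ₐ[k] K))
    (hχ : Function.Injective χ) :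
    Submodule.span K (Set.range fun (l : L) (i : ι) => χ i l) = ⊤ := by
  classical
  have := Fintype.ofFinite ι
  by_contra hne
  obtain ⟨f, hf0, hf⟩ := Submodule.exists_le_ker_of_lt_top _ (lt_top_iff_ne_top.mpr hne)
  have hexp : ∀ v : ι → K, f v = ∑ i, v i * f (Pi.single i 1) := fun v => by
    conv_lhs => rw [pi_eq_sum_univ' v, map_sum]
    simp
  have hind := (linearIndependent_algHom_toLinearMap k L K).comp χ hχ
  rw [Fintype.linearIndependent_iff] at hind
  have h0 := hind (fun i => f (Pi.single i 1)) (by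
    ext l
    have h1 := hf (Submodule.subset_span ⟨l, rfl⟩)
    rw [LinearMap.mem_ker, hexp] at h1
    simpa [mul_comm] using h1)
  exact hf0 (LinearMap.ext fun v => by rw [hexp]; simp [h0])

theorem range_eval_subset_span [Module.Finite k L] {ι : Type*} (χ : ι → (L →ₐ[k] K)) :
    (Set.range fun (l : L) (i : ι) => χ i l) ⊆
      Submodule.span K (Set.range fun (j : Fin (Module.finrank k L)) (i : ι) =>
        χ i (Module.finBasis k L j)) := by
  rintro _ ⟨l, rfl⟩
  have h : (fun i => χ i l) = ∑ j, algebraMap k K ((Module.finBasis k L).repr l j) •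
      fun i => χ i (Module.finBasis k L j) := by
    funext i
    conv_lhs => rw [← (Module.finBasis k L).sum_repr l]
    simp [Algebra.smul_def]
  change (fun i => χ i l) ∈ _
  rw [h]
  exact Submodule.sum_mem _ fun j _ => Submodule.smul_mem _ _ (Submodule.subset_span ⟨j, rfl⟩)

theorem card_algHom_eq_finrank [Module.Finite k L] [Algebra.Etale k L] [IsSepClosed K] :
    Nat.card (L →ₐ[k] K) = Module.finrank k L := by
  classical
  have hfin : Finite (L →ₐ[k] K) := inferInstance
  apply le_antisymm
  · have := Fintype.ofFinite (L →ₐ[k] K)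
    rw [Nat.card_eq_fintype_card, ← Module.finrank_fintype_fun_eq_card (R := K),
      ← finrank_top K (_ → K), ← span_range_eval_eq_top (k := k) (L := L) id Function.injective_id]
    exact (Submodule.finrank_mono (Submodule.span_le.mpr (range_eval_subset_span id))).trans
      ((finrank_range_le_card _).trans (by simp))
  · have E := Algebra.FormallyEtale.equivPiOfIsSepClosed K (TensorProduct k K L)
    have : IsArtinianRing (TensorProduct k K L) := isArtinian_of_tower K inferInstance
    have := Fintype.ofFinite (PrimeSpectrum (TensorProduct k K L))
    have h1 : Module.finrank k L = Nat.card (PrimeSpectrum (TensorProduct k K L)) := by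
      rw [← Module.finrank_baseChange (R := K), E.toLinearEquiv.finrank_eq,
        Module.finrank_fintype_fun_eq_card, Nat.card_eq_fintype_card]
    rw [h1]
    refine Nat.card_le_card_of_injective (fun p => (((Pi.evalAlgHom K (fun _ => K) p).comp
      E.toAlgHom).restrictScalars k).comp Algebra.TensorProduct.includeRight) fun p q h => ?_
    by_contra hpq
    have h2 : (Pi.evalAlgHom K (fun _ => K) p).comp E.toAlgHom =
        (Pi.evalAlgHom K (fun _ => K) q).comp E.toAlgHom :=
      Algebra.TensorProduct.ext (by ext) h
    have h3 := congrArg (fun φ => φ (E.symm (Pi.single p 1))) h2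
    simp [hpq] at h3

open scoped Classical in
/-- The values `χ_s(l)` for `s ∈ D`, extended by `0` to all of `S`. -/
noncomputable def restrictEval (χ : S → (L →ₐ[k] K)) (D : Set S) (l : L) (s : S) : K :=
  if s ∈ D then χ s l else 0

open scoped Classical in
/-- There are `d = |D|` elements of `L` such that the matrix of the values `χ_s(c_j)`, `s ∈ D`, is
invertible. -/
theorem exists_inverse_restrictEval (χ : S → (L →ₐ[k] K)) (hχ : Function.Injective χ)
    {D : Set S} {d : ℕ} (hD : D.ncard = d) :
    ∃ (c : Fin d → L) (M : S → Fin d → K),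
      (∀ i j, ∑ s, restrictEval χ D (c j) s * M s i = if j = i then 1 else 0) ∧
      ∀ s s', ∑ j, M s j * restrictEval χ D (c j) s' = if s = s' ∧ s ∈ D then 1 else 0 := by
  have hspan := span_range_eval_eq_top (fun s : D => χ s) (hχ.comp Subtype.val_injective)
  have hd : Module.finrank K (Submodule.span K (Set.range fun (l : L) (s : D) => χ s l)) = d := by
    rw [hspan, finrank_top, Module.finrank_fintype_fun_eq_card, ← hD, ← Nat.card_coe_set_eq,
      Nat.card_eq_fintype_card]
  obtain ⟨f, hf, hfi⟩ : ∃ f : Fin d → D → K,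
      (∀ i, f i ∈ Set.range fun (l : L) (s : D) => χ s l) ∧ LinearIndependent K f := by
    have h := Submodule.exists_fun_fin_finrank_span_eq K (Set.range fun (l : L) (s : D) => χ s l)
    rw [hd] at h
    obtain ⟨f, hf, -, hfi⟩ := h
    exact ⟨f, hf, hfi⟩
  choose c hc using hf
  obtain rfl : (fun j (s : D) => χ s (c j)) = f := funext hc
  let b : Module.Basis (Fin d) K (D → K) := basisOfLinearIndependentOfCardEqFinrank' _ hfi (by
    rw [Fintype.card_fin, ← hd, hspan, finrank_top])
  have hb : ∀ j, b j = fun s : D => χ s (c j) := fun j => by simp [b]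
  refine ⟨c, fun s j => if h : s ∈ D then b.repr (Pi.single ⟨s, h⟩ 1) j else 0, fun i j => ?_,
    fun s s' => ?_⟩
  · have h1 : ∑ s : D, χ s (c j) • Pi.single s (1 : K) = b j := by
      rw [hb]
      exact (pi_eq_sum_univ' _).symm
    have h2 : ∑ s : D, χ s (c j) * b.repr (Pi.single s 1) i = if j = i then 1 else 0 := by
      rw [← Finsupp.single_apply, ← b.repr_self, ← h1]
      simp
    have h3 := Finset.sum_subtype (p := (· ∈ D)) (F := inferInstanceAs (Fintype D))
      (Finset.univ.filter (· ∈ D)) (by simp)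
      fun s => χ s (c j) * if h : s ∈ D then b.repr (Pi.single ⟨s, h⟩ 1) i else 0
    rw [← h2, Finset.sum_congr rfl fun (s : D) _ => show χ s (c j) * b.repr (Pi.single s 1) i =
      χ s (c j) * if h : (s : S) ∈ D then b.repr (Pi.single ⟨s, h⟩ 1) i else 0 by simp,
      ← h3, Finset.sum_filter]
    refine Finset.sum_congr rfl fun s _ => ?_
    by_cases h : s ∈ D <;> simp [restrictEval, h]
  · by_cases hs : s ∈ D
    · have h1 := congrFun (b.sum_repr (Pi.single ⟨s, hs⟩ 1))
      by_cases hs' : s' ∈ D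
      · have h2 := h1 ⟨s', hs'⟩
        simp only [hb, Finset.sum_apply, Pi.smul_apply, smul_eq_mul, Pi.single_apply,
          Subtype.mk.injEq] at h2
        simp [restrictEval, hs, hs', h2, eq_comm]
      · have : s ≠ s' := fun h => hs' (h ▸ hs)
        simp [restrictEval, hs', this]
    · simp [hs]

theorem restrictEval_smul {χ : S → (L →ₐ[k] K)}
    (he : ∀ (σ : K ≃ₐ[k] K) (s : S), χ (σ • s) = (σ : K →ₐ[k] K).comp (χ s))
    {D D' : Set S} {g : K ≃ₐ[k] K} (h : ∀ s, g • s ∈ D' ↔ s ∈ D) (l : L) (s : S) :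
    restrictEval χ D' l (g • s) = g (restrictEval χ D l s) := by
  by_cases hs : s ∈ D <;> simp [restrictEval, h, hs, he]

theorem sum_comp_smul {M : Type*} [AddCommMonoid M] (g : K ≃ₐ[k] K) (F : S → M) :
    ∑ s, F (g • s) = ∑ s, F s :=
  Equiv.sum_comp (MulAction.toPerm g) F

/-- Every equivariant family of `d`-element subsets of `S = Hom_k(L, K)` has a frame. The linear
forms are `∑_{s ∈ C p} s(c) X_s` with `c ∈ L`. They are equivariant in `p` as long as `c` only
depends on the orbit of `p`, so that Hilbert's theorem 90 is not needed. -/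
theorem nonempty_frame {χ : S → (L →ₐ[k] K)} (hχ : Function.Injective χ)
    (he : ∀ (σ : K ≃ₐ[k] K) (s : S), χ (σ • s) = (σ : K →ₐ[k] K).comp (χ s))
    {C : P → Set S} (hC : IsEquivariantFamily C) {d : ℕ} (hd : ∀ p, (C p).ncard = d) :
    Nonempty (Frame C d) := by
  classical
  let r : P → P := fun p => Quotient.out (Quotient.mk (MulAction.orbitRel (K ≃ₐ[k] K) P) p)
  have hr : ∀ (g : K ≃ₐ[k] K) p, r (g • p) = r p := fun g p =>
    congrArg Quotient.out (Quotient.sound (s := MulAction.orbitRel (K ≃ₐ[k] K) P)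
      (MulAction.mem_orbit p g))
  have hr' : ∀ p, ∃ g : K ≃ₐ[k] K, g • r p = p := fun p =>
    MulAction.orbitRel_apply.mp 
      ((MulAction.orbitRel (K ≃ₐ[k] K) P).symm
        (Quotient.mk_out (s := MulAction.orbitRel (K ≃ₐ[k] K) P) p))
  choose c M hM hM' using fun p => exists_inverse_restrictEval χ hχ (hd p)
  choose g hg using hr'
  have key : ∀ p j s, restrictEval χ (C p) (c (r p) j) s =
      g p (restrictEval χ (C (r p)) (c (r p) j) ((g p)⁻¹ • s)) := fun p j s => by
    rw [← restrictEval_smul he (D' := C p) fun s => by rw [← hC (g p) (r p) s, hg], smul_inv_smul]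
  refine ⟨⟨fun p j => restrictEval χ (C p) (c (r p) j), fun p s j => g p (M (r p) ((g p)⁻¹ • s) j),
    fun h p j s => ?_, fun p i j => ?_, fun p s s' => ?_⟩⟩
  · rw [hr, restrictEval_smul he (hC h p)]
  · simp_rw [key, ← map_mul, ← map_sum]
    rw [sum_comp_smul (g p)⁻¹ fun s =>
      restrictEval χ (C (r p)) (c (r p) j) s * M (r p) s i, hM]
    split_ifs <;> simp
  · simp_rw [key, ← map_mul, ← map_sum, hM', smul_left_cancel_iff]
    have : (g p)⁻¹ • s ∈ C (r p) ↔ s ∈ C p := by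
      rw [← hC (g p) (r p), hg, smul_inv_smul]
    rw [this]
    split_ifs <;> simp

end Frames

/-! ### The unit torus as the complement of the coordinate hyperplanes -/

section UnitTorus

open TensorProduct

variable {k : Type u} [Field k] {K : Type u} [Field K] [Algebra k K]
variable {S P : FinGSet (K ≃ₐ[k] K)}
variable {L : Type u} [CommRing L] [Algebra k L] [Module.Finite k L]

open scoped Classical in
/-- If `L` is split by characters `χ_s` over the `k`-algebra `R`, the norm of an element of `R ⊗ L`
is the product of its images under the characters. The matrix `M` is the inverse of the matrix of
the values of the characters on the basis of `L`. -/
theorem norm_pointOf_eq_prod {R : Type u} [CommRing R] [Algebra k R] {ι : Type*} [Fintype ι]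
    (χ : ι → (L →ₐ[k] R)) (M : Matrix (Fin (Module.finrank k L)) ι R)
    (h1 : ∀ j i, ∑ s, M j s * χ s (Module.finBasis k L i) = if j = i then 1 else 0)
    (h2 : ∀ s t, ∑ j, χ s (Module.finBasis k L j) * M j t = if s = t then 1 else 0)
    (x : Fin (Module.finrank k L) → R) :
    Algebra.norm R (pointOf k L x) = ∏ s, ∑ j, x j * χ s (Module.finBasis k L j) := by
  let b := Module.finBasis k L
  let V : Matrix ι (Fin (Module.finrank k L)) R := fun s j => χ s (b j)
  have hVM : V * M = 1 := by
    ext s t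
    rw [Matrix.mul_apply, Matrix.one_apply]
    exact h2 s t
  have hMV : M * V = 1 := by
    ext s t
    rw [Matrix.mul_apply, Matrix.one_apply]
    exact h1 s t
  let φ : ι → (R ⊗[k] L →ₐ[R] R) := fun s =>
    Algebra.TensorProduct.lift (Algebra.ofId R R) (χ s) fun _ _ => Commute.all _ _
  have hφ : ∀ s, φ s (pointOf k L x) = ∑ j, x j * χ s (b j) := fun s => by
    simp [φ, pointOf, b]
  let A := Algebra.leftMulMatrix (Algebra.TensorProduct.basis R b) (pointOf k L x)
  have hVA : V * A = Matrix.diagonal (fun s => ∑ j, x j * χ s (b j)) * V := by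
    ext s j
    rw [Matrix.diagonal_mul, Matrix.mul_apply]
    have h3 := (Algebra.TensorProduct.basis R b).sum_repr
      (pointOf k L x * Algebra.TensorProduct.basis R b j)
    have h4 := congrArg (φ s) h3
    rw [map_mul (φ s), hφ, map_sum] at h4
    simp only [map_smul, Algebra.TensorProduct.basis_apply] at h4
    have h5 : ∀ i, φ s (1 ⊗ₜ[k] b i) = V s i := fun i => by simp [φ, V]
    simp only [h5, smul_eq_mul] at h4
    rw [← h4]
    refine Finset.sum_congr rfl fun i _ => ?_
    simp only [A, Algebra.leftMulMatrix_eq_repr_mul, Algebra.TensorProduct.basis_apply]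
    exact mul_comm _ _
  rw [Algebra.norm_eq_matrix_det (Algebra.TensorProduct.basis R b), ← Matrix.det_diagonal,
    ← Matrix.det_conj_of_mul_eq_one hVM hMV]
  congr 1
  change V * A * M = _
  rw [hVA, Matrix.mul_assoc, hVM, Matrix.mul_one]

/-- The basis of `K ^ S` given by the vectors of values of the basis of `L`. It comes from the
splitting `K ⊗ L ≅ K ^ S`. -/
noncomputable def evalBasis [Algebra.Etale k L] [IsSepClosed K] (χ : S ≃ (L →ₐ[k] K)) :
    Module.Basis (Fin (Module.finrank k L)) K (S → K) :=
  basisOfTopLeSpanOfCardEqFinrank (fun j s => χ s (Module.finBasis k L j)) (by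
    rw [← span_range_eval_eq_top (k := k) (L := L) (fun s => χ s) χ.injective, Submodule.span_le]
    exact range_eval_subset_span _) (by
    rw [Fintype.card_fin, Module.finrank_fintype_fun_eq_card, ← card_algHom_eq_finrank (K := K),
      ← Nat.card_congr χ, Nat.card_eq_fintype_card])

theorem evalBasis_apply [Algebra.Etale k L] [IsSepClosed K] (χ : S ≃ (L →ₐ[k] K)) (j) (s : S) :
    evalBasis χ j s = χ s (Module.finBasis k L j) := by
  simp [evalBasis]

theorem evalBasis_repr_smul [Algebra.Etale k L] [IsSepClosed K] (χ : S ≃ (L →ₐ[k] K))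
    (he : ∀ (σ : K ≃ₐ[k] K) (s : S), χ (σ • s) = (σ : K →ₐ[k] K).comp (χ s)) [DecidableEq S]
    (g : K ≃ₐ[k] K) (s : S) (j) :
    (evalBasis χ).repr (Pi.single (g • s) 1) j = g ((evalBasis χ).repr (Pi.single s 1) j) := by
  have h : (Pi.single (g • s) 1 : S → K) =
      ∑ j, g ((evalBasis χ).repr (Pi.single s 1) j) • evalBasis χ j := by
    funext t
    obtain ⟨t, rfl⟩ := MulAction.surjective g t
    have h1 := congrArg g (congrFun ((evalBasis χ).sum_repr (Pi.single s 1)) t)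
    simp only [Finset.sum_apply, Pi.smul_apply, smul_eq_mul, map_sum, map_mul,
      evalBasis_apply] at h1 ⊢
    simp only [he, AlgHom.comp_apply]
    refine Eq.trans ?_ h1.symm
    simp only [Pi.single_apply, smul_left_cancel_iff]
    split_ifs <;> simp
  rw [h, Module.Basis.repr_sum_self]

open scoped Classical in
/-- The frame of the constant bundle with fibre `K ^ S` whose `j`-th linear form is the `j`-th
coordinate on `K ⊗ L ≅ K ^ S` with respect to the basis of `L`. -/
noncomputable def tautologicalFrame [Algebra.Etale k L] [IsSepClosed K] (χ : S ≃ (L →ₐ[k] K))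
    (he : ∀ (σ : K ≃ₐ[k] K) (s : S), χ (σ • s) = (σ : K →ₐ[k] K).comp (χ s))
    {C : P → Set S} (hC : ∀ p, C p = Set.univ) : Frame C (Module.finrank k L) where
  toCoord _ j s := (evalBasis χ).repr (Pi.single s 1) j
  ofCoord _ s j := χ s (Module.finBasis k L j)
  toCoord_smul g _ j s := evalBasis_repr_smul χ he g s j
  toCoord_mul_ofCoord _ i j := by
    have h : ∑ s, χ s (Module.finBasis k L i) • Pi.single s (1 : K) = evalBasis χ i := by
      simp_rw [← evalBasis_apply]
      exact (pi_eq_sum_univ' _).symm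
    have h1 := congrArg (fun v => (evalBasis χ).repr v j) h
    simp only [map_sum, map_smul, Finsupp.coe_finsetSum, Finset.sum_apply, Finsupp.smul_apply,
      smul_eq_mul, Module.Basis.repr_self, Finsupp.single_apply] at h1
    simp_rw [mul_comm, h1, eq_comm]
  ofCoord_mul_toCoord _ s s' := by
    have h := congrFun ((evalBasis χ).sum_repr (Pi.single s' 1)) s
    simp only [Finset.sum_apply, Pi.smul_apply, smul_eq_mul, evalBasis_apply,
      Pi.single_apply] at h
    rw [Finset.sum_congr rfl fun j _ => mul_comm _ _, h, hC]
    simp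

theorem bijective_algebraMap_equivariantMaps [IsGalois k K] (P : FinGSet (K ≃ₐ[k] K))
    [Nonempty P] [Subsingleton P] :
    Function.Bijective (algebraMap k (equivariantMaps k K P)) := by
  obtain ⟨p⟩ := ‹Nonempty P›
  constructor
  · intro x y h
    exact (algebraMap k K).injective (congrFun (congrArg Subtype.val h) p)
  · intro f
    obtain ⟨x, hx⟩ := (InfiniteGalois.mem_range_algebraMap_iff_fixed (f.1 p)).mpr fun g => by
      rw [← f.2, Subsingleton.elim (g • p) p]
    refine ⟨x, Subtype.ext <| funext fun q => ?_⟩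
    rw [Subsingleton.elim q p, ← hx]
    rfl

/-- In the coordinates of `L`, the product of the coordinates of `K ^ S` is the norm form. So the
unit torus of `L` is the nonvanishing locus of this product on the bundle over the one-point set
with fibre `K ^ S`. -/
theorem cls_unitTorus [Algebra.Etale k L] [IsSepClosure k K] (χ : S ≃ (L →ₐ[k] K))
    (he : ∀ (σ : K ≃ₐ[k] K) (s : S), χ (σ • s) = (σ : K →ₐ[k] K).comp (χ s))
    [Nonempty P] [Subsingleton P] {C : P → Set S} (hCu : ∀ p, C p = Set.univ)
    (hC : IsEquivariantFamily C) [Algebra.FiniteType k (bundleRing C)] :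
    cls (unitTorus k L) = cls (specVar k (Localization.Away (coordNorm hC))) := by
  classical
  have := IsSepClosure.sep_closed (K := K) k
  let B := tautologicalFrame χ he hCu
  let Ψ : MvPolynomial (Fin (Module.finrank k L)) k ≃ₐ[k] bundleRing C :=
    (MvPolynomial.mapAlgEquiv (Fin (Module.finrank k L)) (AlgEquiv.ofBijective
      (Algebra.ofId k (equivariantMaps k K P)) (bijective_algebraMap_equivariantMaps P))).trans
      B.bundleRingEquiv
  have hΨ : ∀ F p, (Ψ F).1 p = MvPolynomial.aeval (B.linearForm p) F := by
    intro F p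
    have : (Pi.evalAlgHom k (fun _ : P => MvPolynomial S K) p).comp
        ((bundleRing C).val.comp Ψ.toAlgHom) = MvPolynomial.aeval (B.linearForm p) := by
      ext1 j
      simp [Ψ, Frame.bundleRingEquiv, Frame.toBundleRing_apply, Frame.subst]
    exact congrArg (fun φ => φ F) this
  have hN : Ψ (normForm k L) = coordNorm hC := by
    refine Subtype.ext <| funext fun p => ?_
    rw [hΨ, ← norm_pointOf]
    rw [norm_pointOf_eq_prod
      (fun s => (IsScalarTower.toAlgHom k K (MvPolynomial S K)).comp (χ s))
      fun j s => MvPolynomial.C (B.toCoord p j s)]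
    · simp only [coordNorm, coordProd, hCu, Set.mem_univ, Finset.filter_true]
      refine Finset.prod_congr rfl fun s _ => ?_
      have h := B.subst_invSubst p (MvPolynomial.X s)
      rw [coordProj_X_of_mem (by simp [hCu])] at h
      rw [← h]
      simp only [Frame.invSubst, Frame.subst, MvPolynomial.aeval_X, map_sum, map_mul,
        MvPolynomial.algHom_C]
      exact Finset.sum_congr rfl fun j _ => mul_comm _ _
    · intro j i
      have h := congrArg (MvPolynomial.C (σ := S)) (B.toCoord_mul_ofCoord p i j)
      rw [map_sum] at h
      simp only [map_mul] at h
      refine h.trans ?_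
      split_ifs <;> simp
    · intro s t
      have h := congrArg (MvPolynomial.C (σ := S)) (B.ofCoord_mul_toCoord p s t)
      rw [map_sum] at h
      simp only [map_mul] at h
      refine h.trans ?_
      simp only [hCu, Set.mem_univ, and_true]
      split_ifs <;> simp
  refine cls_specVar_congr (IsLocalization.algEquivOfAlgEquiv (M := Submonoid.powers (normForm k L))
    (T := Submonoid.powers (coordNorm hC)) _ _ Ψ ?_)
  rw [Submonoid.map_powers]
  congr 1

end UnitTorus

/-! ### Stratification by the number of nonvanishing coordinates -/

section Stratification

variable {k : Type u} [Field k] {K : Type u} [Field K] [Algebra k K]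
variable {S P Q : FinGSet (K ≃ₐ[k] K)}

/-- The ideal of the functions that vanish on the coordinate subspaces of dimension less than `e`
in each fibre, i.e. on the points with fewer than `e` nonzero coordinates. -/
def vanishIdeal (C : P → Set S) (e : ℕ) : Ideal (bundleRing C) where
  carrier := {f | ∀ p, ∀ E ⊆ C p, E.ncard < e → coordProj E (f.1 p) = 0}
  add_mem' := fun ha hb p E hE he => by
    change coordProj E (_ + _) = 0
    rw [map_add, ha p E hE he, hb p E hE he, add_zero]
  zero_mem' := fun p E _ _ => map_zero _
  smul_mem' := fun c f hf p E hE he => by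
    change coordProj E (_ * _) = 0
    rw [map_mul, hf p E hE he, mul_zero]

theorem vanishIdeal_zero (C : P → Set S) : vanishIdeal C 0 = ⊤ :=
  Ideal.eq_top_iff_one _ |>.mpr fun _ _ _ h => absurd h (Nat.not_lt_zero _)

theorem vanishIdeal_anti (C : P → Set S) (e : ℕ) : vanishIdeal C (e + 1) ≤ vanishIdeal C e :=
  fun _ hf p E hE he => hf p E hE (he.trans e.lt_succ_self)

theorem vanishIdeal_eq_bot {C : P → Set S} {e : ℕ} (h : ∀ p, (C p).ncard < e) :
    vanishIdeal C e = ⊥ := by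
  refine (Submodule.eq_bot_iff _).mpr fun f hf => Subtype.ext <| funext fun p => ?_
  rw [← f.2.1 p]
  exact hf p (C p) subset_rfl (h p)

/-- The Galois set `Q` over `P` parametrizes, via `D`, the pairs of a point `p` of `P` and an
`e`-element subset of `C p`, i.e. the `e`-dimensional coordinate subspaces of the fibres. -/
structure IsRefinement (C : P → Set S) (D : Q → Set S) (e : ℕ) (π : Q → P) : Prop where
  map_smul : ∀ (g : K ≃ₐ[k] K) (q : Q), π (g • q) = g • π q
  subset : ∀ q, D q ⊆ C (π q)
  ncard_eq : ∀ q, (D q).ncard = e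
  ext : ∀ q q', π q = π q' → D q = D q' → q = q'
  exists_eq : ∀ p, ∀ E ⊆ C p, E.ncard = e → ∃ q, π q = p ∧ D q = E

namespace IsRefinement

variable {C : P → Set S} {D : Q → Set S} {e : ℕ} {π : Q → P} (h : IsRefinement C D e π)

/-- Restriction of functions to the coordinate subspaces parametrized by `Q`. -/
noncomputable def restrict (h : IsRefinement C D e π) (hD : IsEquivariantFamily D) :
    bundleRing C →ₐ[k] bundleRing D :=
  (AlgHom.pi fun q => ((coordProj (D q)).restrictScalars k).comp
    ((Pi.evalAlgHom k (fun _ : P => MvPolynomial S K) (π q)).comp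
      (bundleRing C).val)).codRestrict _ fun f =>
    ⟨fun q => by
      change coordProj (D q) (coordProj (D q) (f.1 (π q))) = coordProj (D q) (f.1 (π q))
      rw [coordProj_coordProj, Set.inter_self],
    fun g q => by
      change coordProj (D (g • q)) (f.1 (π (g • q))) = twist S g (coordProj (D q) (f.1 (π q)))
      rw [twist_coordProj g (hD g q), h.map_smul, f.2.2]⟩

theorem restrict_apply (hD : IsEquivariantFamily D) (f : bundleRing C) (q : Q) :
    (h.restrict hD f).1 q = coordProj (D q) (f.1 (π q)) :=
  rfl

theorem ker_restrict (hD : IsEquivariantFamily D) (he : ∀ p, e ≤ (C p).ncard) :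
    RingHom.ker (h.restrict hD) = vanishIdeal C (e + 1) := by
  ext f
  rw [RingHom.mem_ker]
  constructor
  · intro hf p E hE hEe
    obtain ⟨E', hE', hE'C, hE'e⟩ :=
      Set.exists_subsuperset_card_eq hE (Nat.lt_succ_iff.mp hEe) (he p)
    obtain ⟨q, rfl, rfl⟩ := h.exists_eq p E' hE'C hE'e
    rw [← coordProj_coordProj_of_subset hE', ← h.restrict_apply hD, hf]
    exact map_zero _
  · intro hf
    refine Subtype.ext <| funext fun q => hf (π q) (D q) (h.subset q) ?_
    rw [h.ncard_eq]
    exact e.lt_succ_self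

open scoped Classical in
/-- Functions on the `e`-dimensional coordinate subspaces extend to the whole fibre after
multiplication by the product of the `e` coordinates. The extension is a sum over the subspaces, as
this product vanishes on all the others, and on those of smaller dimension. -/
theorem exists_restrict_eq (hD : IsEquivariantFamily D) (r : bundleRing D) :
    ∃ f ∈ vanishIdeal C e, h.restrict hD f = coordNorm hD * r := by
  have hproj : ∀ E : Set S, E.ncard ≤ e → ∀ q, D q ≠ E → coordProj E (coordProd K (D q)) = 0 :=
    fun E hE q hq => coordProj_coordProd_of_not_subset fun hs =>
      hq (Set.eq_of_subset_of_ncard_le hs (by rwa [h.ncard_eq]))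
  refine ⟨⟨fun p => ∑ q with π q = p, coordProd K (D q) * r.1 q, fun p => ?_, fun g p => ?_⟩,
    fun p E hE he => ?_, Subtype.ext <| funext fun q => ?_⟩
  · rw [map_sum]
    refine Finset.sum_congr rfl fun q hq => ?_
    obtain rfl : π q = p := by simpa using hq
    rw [map_mul, coordProj_coordProd_of_subset (h.subset q), ← r.2.1 q,
      coordProj_coordProj, Set.inter_eq_right.mpr (h.subset q)]
  · rw [map_sum]
    symm
    refine Finset.sum_equiv (MulAction.toPerm g) (fun q => ?_) fun q _ => ?_
    · simp [h.map_smul]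
    · rw [map_mul, twist_coordProd g (hD g q), MulAction.toPerm_apply, r.2.2]
  · rw [map_sum]
    refine Finset.sum_eq_zero fun q _ => ?_
    rw [map_mul, hproj E he.le q, zero_mul]
    rintro rfl
    exact he.ne (h.ncard_eq q)
  · rw [restrict_apply, map_sum, Finset.sum_eq_single q]
    · rw [map_mul, coordProj_coordProd_of_subset subset_rfl, r.2.1]
      rfl
    · intro q' hq' hne
      rw [map_mul, hproj (D q) (h.ncard_eq q).le q', zero_mul]
      exact fun hD' => hne (h.ext q' q (by simpa using hq') hD')
    · simp

theorem coordNorm_dvd_restrict (hD : IsEquivariantFamily D) {f : bundleRing C}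
    (hf : f ∈ vanishIdeal C e) : coordNorm hD ∣ h.restrict hD f := by
  have h1 : ∀ q, coordProd K (D q) ∣ (h.restrict hD f).1 q := fun q => by
    refine coordProd_dvd ((h.restrict hD f).2.1 q) fun s hs => ?_
    rw [restrict_apply, coordProj_coordProj_of_subset Set.sdiff_subset]
    refine hf (π q) _ (Set.sdiff_subset.trans (h.subset q)) ?_
    rw [← h.ncard_eq q]
    exact Set.ncard_sdiff_singleton_lt_of_mem hs
  choose r hr using h1
  refine ⟨⟨r, fun q => ?_, fun g q => ?_⟩, Subtype.ext <| funext hr⟩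
  · apply mul_left_cancel₀ (coordProd_ne_zero (K := K) (D q))
    conv_lhs => rw [← coordProj_coordProd_of_subset (K := K) (subset_refl (D q))]
    rw [← map_mul, ← hr, (h.restrict hD f).2.1]
  · apply mul_left_cancel₀ (coordProd_ne_zero (K := K) (D (g • q)))
    rw [← hr, (h.restrict hD f).2.2, hr, map_mul, twist_coordProd g (hD g q)]

/-- The points with at most `e` nonzero coordinates are those with exactly `e`, which form the
bundle of open tori over `Q`, together with those with fewer than `e`. -/
theorem cls_quotient_vanishIdeal (h : IsRefinement C D e π) (hD : IsEquivariantFamily D)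
    (he : ∀ p, e ≤ (C p).ncard)
    [Algebra.FiniteType k (bundleRing C)] [Algebra.FiniteType k (bundleRing D)] :
    cls (specVar k (bundleRing C ⧸ vanishIdeal C (e + 1))) =
      cls (specVar k (Localization.Away (coordNorm hD))) +
        cls (specVar k (bundleRing C ⧸ vanishIdeal C e)) :=
  cls_specVar_quotient_eq_add (h.restrict hD) (coordNorm hD) (h.ker_restrict hD he)
    (vanishIdeal_anti C e) (h.exists_restrict_eq hD) fun _ => h.coordNorm_dvd_restrict hD

end IsRefinement

theorem isRefinement_id {C : P → Set S} {d : ℕ} (hd : ∀ p, (C p).ncard = d) :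
    IsRefinement C C d id where
  map_smul _ _ := rfl
  subset _ := subset_rfl
  ncard_eq := hd
  ext _ _ h _ := h
  exists_eq p E hE he :=
    ⟨p, rfl, (Set.eq_of_subset_of_ncard_le hE (by rw [hd, he])).symm⟩

/-- The class of a bundle of coordinate subspaces is the sum of the classes of its strata. The open
stratum, where no coordinate vanishes, is separated from the others. -/
theorem cls_bundleRing_eq_add_sum {C : P → Set S} (hC : IsEquivariantFamily C) {d : ℕ}
    (hd : ∀ p, (C p).ncard = d) (Q : ℕ → FinGSet (K ≃ₐ[k] K)) (D : ∀ e, Q e → Set S)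
    (π : ∀ e, Q e → P) (h : ∀ e < d, IsRefinement C (D e) e (π e))
    (hD : ∀ e, IsEquivariantFamily (D e)) [Algebra.FiniteType k (bundleRing C)]
    [∀ e, Algebra.FiniteType k (bundleRing (D e))] :
    cls (specVar k (bundleRing C)) = cls (specVar k (Localization.Away (coordNorm hC))) +
      ∑ e ∈ Finset.range d, cls (specVar k (Localization.Away (coordNorm (hD e)))) := by
  have key : ∀ m ≤ d, cls (specVar k (bundleRing C ⧸ vanishIdeal C m)) =
      ∑ e ∈ Finset.range m, cls (specVar k (Localization.Away (coordNorm (hD e)))) := by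
    intro m hm
    induction m with
    | zero =>
      have := Ideal.Quotient.subsingleton_iff.mpr (vanishIdeal_zero C)
      rw [cls_specVar_of_subsingleton, Finset.sum_range_zero]
    | succ m ih =>
      rw [Finset.sum_range_succ, ← ih (by omega), add_comm (cls _)]
      exact (h m (by omega)).cls_quotient_vanishIdeal (hD m) fun p => by rw [hd]; omega
  rw [← key d le_rfl, ← (isRefinement_id hd).cls_quotient_vanishIdeal hC fun p => (hd p).ge]
  exact cls_specVar_congr ((AlgEquiv.quotientBot k (bundleRing C)).symm.trans
    (Ideal.quotientEquivAlgOfEq k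
      (vanishIdeal_eq_bot fun p => by rw [hd]; exact d.lt_succ_self).symm))

end Stratification

/-! ### Sums over compositions -/

section Compositions

/-- The tuples of `t` positive integers with sum at most `n`. -/
def boundedCompositions (n t : ℕ) : Finset (Fin t → ℕ) :=
  (Fintype.piFinset fun _ => Finset.Icc 1 n).filter fun a => ∑ j, a j ≤ n

theorem mem_boundedCompositions {n t : ℕ} {a : Fin t → ℕ} :
    a ∈ boundedCompositions n t ↔ (∀ j, 1 ≤ a j) ∧ ∑ j, a j ≤ n := by
  simp only [boundedCompositions, Finset.mem_filter, Fintype.mem_piFinset, Finset.mem_Icc]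
  refine ⟨fun h => ⟨fun j => (h.1 j).1, h.2⟩, fun h => ⟨fun j => ⟨h.1 j, ?_⟩, h.2⟩⟩
  exact (Finset.single_le_sum (fun _ _ => Nat.zero_le _) (Finset.mem_univ j)).trans h.2

theorem le_sum_of_one_le {t : ℕ} {a : Fin t → ℕ} (h : ∀ j, 1 ≤ a j) : t ≤ ∑ j, a j := by
  simpa using Finset.card_nsmul_le_sum Finset.univ (fun j => a j) 1 fun j _ => h j

variable {M : Type*} [AddCommGroup M]

theorem sum_boundedCompositions_succ (n t : ℕ) (f : (Fin (t + 1) → ℕ) → M) :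
    ∑ a ∈ boundedCompositions n (t + 1), f a =
      ∑ a ∈ boundedCompositions n t, ∑ m ∈ Finset.Icc 1 (n - ∑ j, a j),
        f (Fin.cons m a : Fin (t + 1) → ℕ) := by
  rw [Finset.sum_sigma']
  refine Finset.sum_bij' (fun a _ => ⟨Fin.tail a, a 0⟩) (fun x _ => Fin.cons x.2 x.1) ?_ ?_ ?_ ?_ ?_
  · intro a ha
    simp only [mem_boundedCompositions, Fin.sum_univ_succ, Finset.mem_sigma, Finset.mem_Icc,
      Fin.tail] at ha ⊢
    refine ⟨⟨fun j => ha.1 _, by omega⟩, ha.1 0, by omega⟩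
  · rintro ⟨a, m⟩ h
    simp only [mem_boundedCompositions, Fin.sum_univ_succ, Finset.mem_sigma, Finset.mem_Icc,
      Fin.cons_zero, Fin.cons_succ] at h ⊢
    refine ⟨Fin.cases h.2.1 h.1.1, by omega⟩
  · intro a _
    exact Fin.cons_self_tail a
  · rintro ⟨a, m⟩ _
    simp
  · intro a _
    rw [Fin.cons_self_tail]

/-- Solving a recursion that expresses `v` through `w` and its values on longer tuples. It ends
since there are no tuples of more than `n` positive integers with sum at most `n`. -/
theorem eq_sum_of_recursion (n : ℕ) (v w : ∀ t : ℕ, (Fin t → ℕ) → M)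
    (h : ∀ t a, v t a = w t a + ∑ m ∈ Finset.Icc 1 (n - ∑ j, a j),
      w (t + 1) (Fin.cons m a : Fin (t + 1) → ℕ)) :
    w 0 Fin.elim0 =
      ∑ t ∈ Finset.range (n + 1), ∑ a ∈ boundedCompositions n t, (-1 : ℤ) ^ t • v t a := by
  have key : ∀ T, w 0 Fin.elim0 =
      ∑ t ∈ Finset.range T, ∑ a ∈ boundedCompositions n t, (-1 : ℤ) ^ t • v t a +
        ∑ a ∈ boundedCompositions n T, (-1 : ℤ) ^ T • w T a := by
    intro T
    induction T with
    | zero =>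
      have : boundedCompositions n 0 = {Fin.elim0} := by
        ext a
        simp [mem_boundedCompositions, Subsingleton.elim a Fin.elim0]
      simp [this]
    | succ T ih =>
      rw [ih, Finset.sum_range_succ, sum_boundedCompositions_succ, add_assoc,
        ← Finset.sum_add_distrib]
      congr 1
      refine Finset.sum_congr rfl fun a _ => ?_
      rw [h, smul_add, add_assoc, Finset.smul_sum, ← Finset.sum_add_distrib,
        Finset.sum_eq_zero (f := fun _ => _ + _), add_zero]
      intro m _
      rw [pow_succ, mul_neg_one, neg_smul, add_neg_cancel]
  rw [key (n + 1), add_eq_left, Finset.sum_eq_zero]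
  intro a ha
  obtain ⟨h1, h2⟩ := mem_boundedCompositions.mp ha
  have := le_sum_of_one_le h1
  omega

theorem sum_boundedCompositions_eq (n : ℕ) (f : ∀ t : ℕ, (Fin t → ℕ) → M) :
    ∑ t ∈ Finset.range (n + 1), ∑ a ∈ boundedCompositions n t, f t a =
      f 0 Fin.elim0 + ∑ i ∈ Finset.Icc 1 n, ∑ t ∈ Finset.Icc 1 i,
        ∑ a ∈ (Finset.Nat.antidiagonalTuple t i).filter (fun a => ∀ s, 1 ≤ a s), f t a := by
  have h1 : ∀ t, ∑ a ∈ boundedCompositions n t, f t a = ∑ i ∈ Finset.range (n + 1),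
      ∑ a ∈ (Finset.Nat.antidiagonalTuple t i).filter (fun a => ∀ s, 1 ≤ a s), f t a := by
    intro t
    rw [← Finset.sum_fiberwise_of_maps_to (g := fun a => ∑ j, a j) (t := Finset.range (n + 1))
      fun a ha => by have := (mem_boundedCompositions.mp ha).2; simp; omega]
    refine Finset.sum_congr rfl fun i hi => Finset.sum_congr ?_ fun _ _ => rfl
    ext a
    simp only [Finset.mem_filter, mem_boundedCompositions, Finset.Nat.mem_antidiagonalTuple,
      Finset.mem_range] at hi ⊢
    constructor
    · rintro ⟨⟨h, -⟩, h'⟩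
      exact ⟨h', h⟩
    · rintro ⟨h', h⟩
      exact ⟨⟨h, by omega⟩, h'⟩
  simp_rw [h1]
  rw [Finset.sum_comm, Finset.range_eq_Ico, Finset.sum_eq_sum_Ico_succ_bot (by omega)]
  congr 1
  · rw [Finset.sum_eq_sum_Ico_succ_bot (by omega), Finset.sum_eq_zero (s := Finset.Ico (0 + 1) _),
      add_zero]
    · rw [Finset.sum_eq_single Fin.elim0]
      · exact fun a _ ha => absurd (Subsingleton.elim _ _) ha
      · exact fun ha => absurd (by simp [Subsingleton.elim ![] Fin.elim0]) ha
    · intro t ht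
      refine Finset.sum_eq_zero fun a ha => ?_
      simp only [Finset.mem_filter, Finset.Nat.mem_antidiagonalTuple, Finset.mem_Ico,
        Finset.sum_eq_zero_iff] at ha ht
      have h2 := ha.1 ⟨0, by omega⟩ (Finset.mem_univ _)
      have h3 := ha.2 ⟨0, by omega⟩
      omega
  · refine Finset.sum_congr (by ext; simp) fun i hi => ?_
    refine (Finset.sum_subset (fun t ht => ?_) fun t ht ht' => ?_).symm
    · simp only [Finset.mem_Icc, Finset.mem_Ico] at hi ht ⊢
      omega
    · refine Finset.sum_eq_zero fun a ha => ?_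
      simp only [Finset.mem_filter, Finset.Nat.mem_antidiagonalTuple, Finset.mem_Ico,
        Finset.mem_Icc] at ha ht ht' hi
      exfalso
      have h2 := le_sum_of_one_le ha.2
      obtain rfl : t = 0 := by omega
      have h3 := ha.1
      rw [Fin.sum_univ_zero] at h3
      omega

end Compositions

/-! ### Tuples of disjoint subsets -/

section Tuples

variable {k : Type u} [Field k] {K : Type u} [Field K] [Algebra k K]
variable {S : FinGSet (K ≃ₐ[k] K)} {t : ℕ}

/-- The complement in `S` of the union of a tuple of subsets. -/
def unusedPoints {a : Fin t → ℕ} (F : S.tuples a) : Set S :=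
  (⋃ j, F.1 j)ᶜ

theorem isEquivariantFamily_unusedPoints (a : Fin t → ℕ) :
    IsEquivariantFamily (unusedPoints : S.tuples a → Set S) := by
  intro g F s
  have h : ∀ j, (g • F).1 j = (fun s => g • s) '' F.1 j := fun _ => rfl
  simp [unusedPoints, h]

theorem ncard_unusedPoints {a : Fin t → ℕ} (F : S.tuples a) :
    (unusedPoints F).ncard = Nat.card S - ∑ j, a j := by
  rw [unusedPoints, Set.ncard_compl, Set.ncard_iUnion_of_finite (fun _ => Set.toFinite _) F.2.2,
    finsum_eq_sum_of_fintype]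
  simp_rw [F.2.1]

/-- The tuple of subsets without its first entry. -/
def tailTuple {a : Fin t → ℕ} {m : ℕ} (F : S.tuples (Fin.cons m a : Fin (t + 1) → ℕ)) :
    S.tuples a :=
  ⟨fun j => F.1 j.succ, fun j => F.2.1 j.succ,
    fun i j hij => F.2.2 i.succ j.succ ((Fin.succ_injective _).ne hij)⟩

theorem unusedPoints_eq_sdiff {a : Fin t → ℕ} {m : ℕ}
    (F : S.tuples (Fin.cons m a : Fin (t + 1) → ℕ)) :
    unusedPoints F = unusedPoints (tailTuple F) \ F.1 0 := by
  ext s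
  simp [unusedPoints, tailTuple, Fin.forall_fin_succ, and_comm]

theorem subset_unusedPoints_tailTuple {a : Fin t → ℕ} {m : ℕ}
    (F : S.tuples (Fin.cons m a : Fin (t + 1) → ℕ)) : F.1 0 ⊆ unusedPoints (tailTuple F) := by
  intro s hs
  simp only [unusedPoints, tailTuple, Set.mem_compl_iff, Set.mem_iUnion, not_exists]
  exact fun j hj => Set.disjoint_left.mp (F.2.2 0 j.succ (Fin.succ_ne_zero j).symm) hs hj

/-- Adding an `m`-element subset to a tuple amounts to choosing the remaining unused points. -/
theorem isRefinement_tailTuple (a : Fin t → ℕ) {m : ℕ} (hm : m ≤ Nat.card S - ∑ j, a j) :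
    IsRefinement (unusedPoints : S.tuples a → Set S)
      (unusedPoints : S.tuples (Fin.cons m a : Fin (t + 1) → ℕ) → Set S)
      (Nat.card S - ∑ j, a j - m) tailTuple where
  map_smul _ _ := rfl
  subset F := by
    rw [unusedPoints_eq_sdiff]
    exact Set.sdiff_subset
  ncard_eq F := by
    rw [ncard_unusedPoints, Fin.sum_univ_succ, Fin.cons_zero]
    simp only [Fin.cons_succ]
    omega
  ext F F' h h' := by
    refine Subtype.ext <| funext <| Fin.cases ?_ fun j => congrFun (congrArg Subtype.val h) j
    have h0 : ∀ F : S.tuples (Fin.cons m a : Fin (t + 1) → ℕ),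
        F.1 0 = unusedPoints (tailTuple F) \ unusedPoints F := fun F => by
      rw [unusedPoints_eq_sdiff, Set.sdiff_sdiff_cancel_left (subset_unusedPoints_tailTuple F)]
    rw [h0 F, h0 F', h, h']
  exists_eq F E hE he := by
    have hdisj : ∀ j, Disjoint (unusedPoints F \ E) (F.1 j) := fun j =>
      Set.disjoint_left.mpr fun s hs hj => hs.1 (Set.mem_iUnion_of_mem j hj)
    let F' : S.tuples (Fin.cons m a : Fin (t + 1) → ℕ) :=
      ⟨Fin.cons (unusedPoints F \ E) F.1, Fin.cases (by
          change (unusedPoints F \ E).ncard = m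
          rw [Set.ncard_sdiff hE, ncard_unusedPoints, he]
          omega) F.2.1,
        Fin.cases (Fin.cases (fun h => absurd rfl h) fun j _ => hdisj j)
          fun i => Fin.cases (fun _ => (hdisj i).symm) fun j hij =>
            F.2.2 i j fun h => hij (h ▸ rfl)⟩
    refine ⟨F', rfl, ?_⟩
    rw [unusedPoints_eq_sdiff]
    exact Set.sdiff_sdiff_cancel_left hE

theorem art_rho [IsSepClosure k K] (i : ℕ) (S : FinGSet (K ≃ₐ[k] K)) :
    art k K (rho i S) = ∑ t ∈ Finset.Icc 1 i,
      ∑ a ∈ (Finset.Nat.antidiagonalTuple t i).filter (fun a => ∀ s, 1 ≤ a s),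
        (-1 : ℤ) ^ t • art k K (S.tuples a).cls := by
  rw [rho, map_sum]
  refine Finset.sum_congr rfl fun t _ => ?_
  rw [map_sum]
  refine Finset.sum_congr rfl fun a _ => ?_
  rcases Nat.even_or_odd t with h | h <;> simp [h.neg_one_pow]

end Tuples

end GrothendieckVar

open GrothendieckVar in
theorem theorem82 {k : Type u} [Field k] {K : Type u} [Field K] [Algebra k K] [IsSepClosure k K]
    (L : Type u) [CommRing L] [Algebra k L] [Module.Finite k L] [Algebra.Etale k L]
    (n : ℕ) (hn : Module.finrank k L = n)
    (S : GrothendieckVar.FinGSet (K ≃ₐ[k] K)) (hS : GrothendieckVar.Corresponds k K L S) :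
    GrothendieckVar.cls (GrothendieckVar.unitTorus k L) =
      GrothendieckVar.lefschetz k ^ n +
        ∑ i ∈ Finset.Icc 1 n,
          GrothendieckVar.art k K (GrothendieckVar.rho i S) *
            GrothendieckVar.lefschetz k ^ (n - i) := by
  obtain ⟨χ, hχ⟩ := hS
  have := IsSepClosure.sep_closed (K := K) k
  have hcard : Nat.card S = n := by
    rw [Nat.card_congr χ, card_algHom_eq_finrank, hn]
  have hframe : ∀ (t : ℕ) (a : Fin t → ℕ),
      Nonempty (Frame (unusedPoints : S.tuples a → Set S) (n - ∑ j, a j)) := fun t a =>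
    nonempty_frame χ.injective hχ (isEquivariantFamily_unusedPoints a) fun F => by
      rw [ncard_unusedPoints, hcard]
  have hft : ∀ (t : ℕ) (a : Fin t → ℕ),
      Algebra.FiniteType k (bundleRing (unusedPoints : S.tuples a → Set S)) := fun t a =>
    (hframe t a).some.finiteType_bundleRing
  -- `w t a` is the class of the bundle over the set of tuples of type `a` with fibre the open torus
  -- of the coordinate space of the unused points, and `v t a` that of the bundle of these spaces.
  let w : ∀ t : ℕ, (Fin t → ℕ) → K0Var k := fun t a =>
    cls (specVar k (Localization.Away (coordNorm (isEquivariantFamily_unusedPoints (S := S) a))))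
  let v : ∀ t : ℕ, (Fin t → ℕ) → K0Var k := fun t a =>
    art k K (S.tuples a).cls * lefschetz k ^ (n - ∑ j, a j)
  have hvw : ∀ t a, v t a = w t a + ∑ m ∈ Finset.Icc 1 (n - ∑ j, a j),
      w (t + 1) (Fin.cons m a : Fin (t + 1) → ℕ) := by
    intro t a
    rw [show v t a = _ from ((hframe t a).some.cls_bundleRing).symm,
      cls_bundleRing_eq_add_sum (isEquivariantFamily_unusedPoints a)
        (fun F => by rw [ncard_unusedPoints, hcard]) (d := n - ∑ j, a j)
        (fun e => S.tuples (Fin.cons (n - ∑ j, a j - e) a : Fin (t + 1) → ℕ))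
        (fun e => unusedPoints) (fun e => tailTuple)
        (fun e he => by
          have := isRefinement_tailTuple (S := S) a (m := n - ∑ j, a j - e) (by omega)
          rwa [hcard, Nat.sub_sub_self he.le] at this)
        (fun e => isEquivariantFamily_unusedPoints _)]
    congr 1
    refine Finset.sum_nbij' (fun e => n - ∑ j, a j - e) (fun m => n - ∑ j, a j - m) ?_ ?_ ?_ ?_ ?_
    · simp only [Finset.mem_range, Finset.mem_Icc]
      omega
    · simp only [Finset.mem_range, Finset.mem_Icc]
      omega
    · simp only [Finset.mem_range]
      omega
    · simp only [Finset.mem_Icc]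
      omega
    · exact fun _ _ => rfl
  have hU : ∀ F : S.tuples (Fin.elim0 : Fin 0 → ℕ), unusedPoints F = Set.univ := fun F => by
    simp [unusedPoints]
  have : Nonempty (S.tuples (Fin.elim0 : Fin 0 → ℕ)) :=
    ⟨⟨Fin.elim0, fun j => j.elim0, fun j => j.elim0⟩⟩
  have : Subsingleton (S.tuples (Fin.elim0 : Fin 0 → ℕ)) :=
    ⟨fun F F' => Subtype.ext (Subsingleton.elim _ _)⟩
  have hv0 : v 0 Fin.elim0 = lefschetz k ^ n := by
    simp only [v, art_cls, Finset.univ_eq_empty, Finset.sum_empty, Nat.sub_zero]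
    rw [cls_specVar_eq_one (bijective_algebraMap_equivariantMaps _), one_mul]
  rw [cls_unitTorus χ hχ hU (isEquivariantFamily_unusedPoints _)]
  change w 0 Fin.elim0 = _
  rw [eq_sum_of_recursion n v w hvw,
    sum_boundedCompositions_eq n fun t a => (-1 : ℤ) ^ t • v t a, hv0, pow_zero, one_smul]
  congr 1
  refine Finset.sum_congr rfl fun i _ => ?_
  rw [art_rho, Finset.sum_mul]
  refine Finset.sum_congr rfl fun t _ => ?_
  rw [Finset.sum_mul]
  refine Finset.sum_congr rfl fun a ha => ?_
  rw [Finset.mem_filter, Finset.Nat.mem_antidiagonalTuple] at ha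
  simp only [v, ha.1, smul_mul_assoc]
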